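/- **Definitions.** A $d$-regular graph $G=(V,E)$ is a $(\kappa,\alpha)$-small-set vertex expander if every $S\subseteq V$ with $|S|\le |V|/\kappa$ satisfies $|\{u\in V:\exists v\in S,\ \{u,v\}\in E\}|\ge(1-\alpha)\,d\,|S|$. For a finite $P\subset\mathbb R^D$, a clustering of $P$ is a partition into $k$ (possibly empty) clusters $C_1,\dots,C_k$, and its $k$-means cost is $\sum_{i=1}^k\inf_{c\in\mathbb R^D}\sum_{p\in C_i}\|p-c\|_2^2$. **Theorem.** Let $\delta,\zeta,\alpha>0$ be constants with $\delta\le10^{-3}$, $\zeta\le\delta^5/10$ and $\alpha\le\delta^{10}$. There is a randomized algorithm (a program for a word RAM whose words have $O(\log(\text{input length}))$ bits, which can draw a uniform element of $\{0,\dots,x-1\}$ in one step, and which prints points as sparse vectors) with the following two properties. 1. Given an integer $1\le k\le|V|$ and a $d$-regular graph $G=(V,E)$ with $d\ge1$ (as a list of edges), for every outcome of its random choices it runs in time linear in the input length and outputs a set $P\subseteq\mathbb R^{O(|V|)}$ of at most $|E|$ points. These points are color-coded edge embeddings: for some coloring $\rho:V\to[k]$, $$P=\{\mathbf e_u+\mathbf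 e_v+\mathbf e_{|V|+\rho(u)}+\mathbf e_{|V|+\rho(v)}:\{u,v\}\in E,\ \rho(u)\ne\rho(v)\}.$$ 2. Let $L>1$, $d=d(n)=\Theta((\log n)^L)$, $\kappa=\kappa(n)=(\log n)^{O(1)}$, and let $k=k(n)$ satisfy $k=o(n/d^{g(n)})$ for some $g(n)\to\infty$. Then for all sufficiently large $n$ such that $k>\sqrt n\,d$, and every $d$-regular $(\kappa,\alpha)$-small-set vertex expander $G=(V,E)$ with $|V|=n$, with probability at least $0.95$ the output $P$ on input $(k,G)$ satisfies both of the following. * *Completeness:* if some $\lfloor|V|/2\rfloor$ vertices cover at least a $(1-\zeta)$ fraction of $E$, then there is a clustering of $P$ into $k$ clusters of $k$-means cost at most $3|E|-(1-7\zeta)kd$. * *Soundness:* if every $\lfloor|V|/2\rfloor$ vertices miss at least a $\delta$ fraction of $E$, then every clustering of $P$ into $k$ clusters has $k$-means cost at least $3|E|-(1-\delta^5)kd$. -/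

import Mathlib

open Filter Asymptotics Topology
open scoped ENNReal

/-! ### Graphs -/

/-- `G` is a `d`-regular `(κ, α)`-small set vertex expander: every vertex set `S` of size at most
`|V| / κ` (written `κ * |S| ≤ |V|`) has at least `(1 - α) d |S|` neighbours. As in the usual
definition of the neighbourhood of a set, a neighbour may itself lie in `S`. -/
def IsSmallSetVertexExpander {V : Type*} [Fintype V] [DecidableEq V] (G : SimpleGraph V)
    [DecidableRel G.Adj] (κ : ℕ) (α : ℝ) (d : ℕ) : Prop :=
  G.IsRegularOfDegree d ∧
    ∀ S : Finset V, κ * S.card ≤ Fintype.card V →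
      (1 - α) * d * S.card ≤ ((Finset.univ.filter fun u => ∃ v ∈ S, G.Adj u v).card : ℝ)

/-- The edges of `G` that have an endpoint in `S`. -/
def coveredEdges {V : Type*} [Fintype V] [DecidableEq V] (G : SimpleGraph V)
    [DecidableRel G.Adj] (S : Finset V) : Finset (Sym2 V) :=
  G.edgeFinset.filter fun e => ∃ v ∈ S, v ∈ e

/-- The edges of `G` that have no endpoint in `S`. -/
def missedEdges {V : Type*} [Fintype V] [DecidableEq V] (G : SimpleGraph V)
    [DecidableRel G.Adj] (S : Finset V) : Finset (Sym2 V) :=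
  G.edgeFinset.filter fun e => ¬ ∃ v ∈ S, v ∈ e

/-- The list `es` contains every edge of `G` exactly once, in some order and orientation. -/
def IsEdgeList {V : Type*} (G : SimpleGraph V) (es : List (V × V)) : Prop :=
  (es.map fun e => s(e.1, e.2)).Nodup ∧
    ∀ e : Sym2 V, e ∈ (es.map fun e => s(e.1, e.2)) ↔ e ∈ G.edgeSet

/-! ### Euclidean `k`-means -/

/-- The `k`-means cost of the clustering of `P` into the `k` clusters `{p ∈ P | f p = i}`: each
cluster pays the sum of the squared Euclidean distances to its best centre. A cluster may be
empty; it then costs `0`. -/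
noncomputable def kmeansCost {D k : ℕ} (P : Finset (EuclideanSpace ℝ (Fin D)))
    (f : EuclideanSpace ℝ (Fin D) → Fin k) : ℝ :=
  ∑ i : Fin k, ⨅ c : EuclideanSpace ℝ (Fin D), ∑ p ∈ P with f p = i, dist p c ^ 2

/-! ### Randomized word RAM -/

/-- The instructions of a random access machine with registers, an indirectly addressed memory,
a one-way input tape, a one-way output tape, and a source of random integers. -/
inductive Instr : Type
  /-- register `r` receives the constant `x` -/
  | const (r x : ℕ)
  /-- register `r` receives the sum of registers `a` and `b` -/
  | add (r a b : ℕ)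
  /-- register `r` receives register `a` minus register `b`, or `0` if this is negative -/
  | sub (r a b : ℕ)
  /-- register `r` receives the memory cell whose address is in register `a` -/
  | load (r a : ℕ)
  /-- the memory cell whose address is in register `a` receives register `b` -/
  | store (a b : ℕ)
  /-- register `r` receives the next input word, or `0` at the end of the input -/
  | read (r : ℕ)
  /-- register `r` is appended to the output -/
  | print (r : ℕ)
  /-- register `r` receives a fresh uniformly random element of `{0, …, x - 1}`, where `x` is the
  content of register `a` (and `0` if `x = 0`) -/
  | rand (r a : ℕ)
  /-- jump to instruction `l` if register `r` is positive -/
  | jpos (r l : ℕ)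
  /-- stop -/
  | halt

/-- A configuration of the machine. -/
structure Config : Type where
  pc : ℕ
  reg : ℕ → ℕ
  mem : ℕ → ℕ
  inp : List ℕ
  out : List ℕ

/-- The initial configuration: everything is `0`, and the input is on the input tape. -/
def Config.init (input : List ℕ) : Config :=
  ⟨0, fun _ => 0, fun _ => 0, input, []⟩

/-- Write `x` to register `r` and go on to the next instruction. -/
def Config.set (s : Config) (r x : ℕ) : Config :=
  { s with pc := s.pc + 1, reg := Function.update s.reg r x }

/-- The machine has stopped: it is at a `halt` or has left the program. -/
def Config.Halted (prog : List Instr) (s : Config) : Prop :=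
  prog[s.pc]? = none ∨ prog[s.pc]? = some Instr.halt

/-- The uniform distribution on `{0, …, x - 1}` (the point mass at `0` if `x = 0`). -/
noncomputable def uniformBelow (x : ℕ) : PMF ℕ :=
  if h : (Finset.range x).Nonempty then PMF.uniformOfFinset (Finset.range x) h else PMF.pure 0

/-- One step of the machine with words of `w` bits: everything that enters a register is reduced
modulo `2 ^ w`, so registers, memory cells and addresses are always smaller than `2 ^ w`.
A stopped machine does not change any more. -/
noncomputable def step (w : ℕ) (prog : List Instr) (s : Config) : PMF Config :=
  match prog[s.pc]? with
  | none => PMF.pure s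
  | some Instr.halt => PMF.pure s
  | some (Instr.const r x) => PMF.pure (s.set r (x % 2 ^ w))
  | some (Instr.add r a b) => PMF.pure (s.set r ((s.reg a + s.reg b) % 2 ^ w))
  | some (Instr.sub r a b) => PMF.pure (s.set r (s.reg a - s.reg b))
  | some (Instr.load r a) => PMF.pure (s.set r (s.mem (s.reg a)))
  | some (Instr.store a b) =>
      PMF.pure { s with pc := s.pc + 1, mem := Function.update s.mem (s.reg a) (s.reg b) }
  | some (Instr.read r) =>
      PMF.pure { (s.set r (s.inp.headD 0 % 2 ^ w)) with inp := s.inp.tail }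
  | some (Instr.print r) => PMF.pure { s with pc := s.pc + 1, out := s.out ++ [s.reg r] }
  | some (Instr.rand r a) => (uniformBelow (s.reg a)).map fun x => s.set r x
  | some (Instr.jpos r l) => PMF.pure { s with pc := if 0 < s.reg r then l else s.pc + 1 }

/-- The distribution of the configuration after `t` steps from `s`. -/
noncomputable def runSteps (w : ℕ) (prog : List Instr) : ℕ → Config → PMF Config
  | 0, s => PMF.pure s
  | t + 1, s => (step w prog s).bind (runSteps w prog t)

/-- The distribution of the configuration that `prog` reaches on `input` after `C * |input|` steps,
where `|input|` is the number of input words and the word length is `c` times the number of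
binary digits of `|input|`. -/
noncomputable def runLinear (prog : List Instr) (c C : ℕ) (input : List ℕ) : PMF Config :=
  runSteps (c * input.length.size) prog (C * input.length) (Config.init input)

/-! ### Input and output format -/

/-- The input words for the integer `k` and a graph on `Fin n` with edge list `es`. -/
def graphInput (n k : ℕ) (es : List (Fin n × Fin n)) : List ℕ :=
  n :: k :: es.length :: es.flatMap fun e => [(e.1 : ℕ), (e.2 : ℕ)]

/-- The output words for a list of sparse vectors in dimension `D`: first `D`, then, for each
vector, the number of its listed entries followed by these entries (coordinate, value). -/
def encodeOutput (D : ℕ) (pts : List (List (ℕ × ℕ))) : List ℕ :=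
  D :: pts.flatMap fun s => s.length :: s.flatMap fun q => [q.1, q.2]

/-- The vector in `ℝ ^ D` with the listed entries and zeros elsewhere (entries listed for the
same coordinate add up). -/
noncomputable def sparsePoint (D : ℕ) (s : List (ℕ × ℕ)) : EuclideanSpace ℝ (Fin D) :=
  WithLp.toLp 2 fun j => (((s.filter fun q => q.1 = (j : ℕ)).map fun q => q.2).sum : ℝ)

open Classical in
/-- The point set given by a list of sparse vectors. -/
noncomputable def pointSet (D : ℕ) (pts : List (List (ℕ × ℕ))) :
    Finset (EuclideanSpace ℝ (Fin D)) :=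
  (pts.map (sparsePoint D)).toFinset

/-- The colour-coded embedding `e_u + e_v + e_{n + ρ(u)} + e_{n + ρ(v)}` of the edge `uv`, for the
vertex colouring `ρ`. -/
noncomputable def edgePoint (D : ℕ) {n k : ℕ} (ρ : Fin n → Fin k) (u v : Fin n) :
    EuclideanSpace ℝ (Fin D) :=
  WithLp.toLp 2 fun j =>
    (if (j : ℕ) = u then 1 else 0) + (if (j : ℕ) = v then 1 else 0) +
      (if (j : ℕ) = n + ρ u then 1 else 0) + (if (j : ℕ) = n + ρ v then 1 else 0)

/-! A bichromatic edge point has squared norm 4, so a cluster C of such points, with its mean as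
centre, costs 4|C| - `savings ρ C`: the savings are the sum of the squared vertex degrees and
squared colour degrees of C, divided by |C|. Both halves of the theorem are statements about savings
under a random colouring.

Completeness (`exists_kmeansCost_le_of_cover`). Let S be half of the vertices, covering nearly all
edges. Send each edge to the cluster named by the colour of an endpoint, chosen in S whenever
possible. The centre of cluster i has weight 1 at colour i, which brings the cost of each edge down
to 3, and weight 2k/n at the roughly n/(2k) vertices of S of colour i. If the classes of S have
nearly equal sizes, the vertex weights save a further kd, approximately.

Soundness (`sum_savings_le`). The savings of a cluster exceed its size by at most (1 + 6η)d; let x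
be the shortfall from this bound. If x is small and the cluster is not, then nearly all its edges
meet a single colour class, in vertices whose degree inside the cluster is nearly d
(`SpreadEdges.savings_cases`, `SpreadEdges.exists_cover`). This uses that any two colours are joined
by at most ηd edges, so that no second colour class contributes much; clusters of at most 100d edges
are controlled by simplicity of the graph instead. If the total savings were too large, the
shortfalls would add up to at most 2δ⁵kd. The heavy vertices of all clusters would then miss only
O(δ²)|E| edges, and there would be at most (1 + δ/9)n/2 of them, since each uses up (1 - δ/10)d
edges of its own cluster. Trimming them to half of the vertices contradicts the assumption.

Randomness (`card_goodColouring_ge`). Markov's inequality bounds the monochromatic edges and the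
unevenness of the classes of V and of one S fixed before the colouring. Many edges between two
colours would produce either four equally coloured neighbours of one vertex or a large matching
between the colours; union bounds exclude both.

Machine (`exists_final_configs`). Lower bounds on probabilities suffice: each of the kⁿ colourings
has its own final configuration, reached with probability at least k⁻ⁿ. These bounds already add up
to 1, so there are no other outcomes. -/

/-! ### Degrees in multigraphs -/

/-- The degree of `x` in the multigraph whose edges `e ∈ C` join `p e` and `q e`. -/
noncomputable def mdeg {ι X : Type*} [DecidableEq X] (p q : ι → X) (C : Finset ι) (x : X) : ℝ :=
  ∑ e ∈ C, ((if p e = x then 1 else 0) + (if q e = x then 1 else 0))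

section Mdeg

variable {ι X : Type*} [DecidableEq X] {p q : ι → X} {C : Finset ι}

lemma mdeg_nonneg (x : X) : 0 ≤ mdeg p q C x :=
  Finset.sum_nonneg fun e _ => by positivity

lemma mdeg_mono {C' : Finset ι} (h : C ⊆ C') (x : X) : mdeg p q C x ≤ mdeg p q C' x :=
  Finset.sum_le_sum_of_subset_of_nonneg h fun e _ _ => by positivity

lemma mdeg_filter_add (r : ι → Prop) [DecidablePred r] (x : X) :
    mdeg p q (C.filter r) x + mdeg p q (C.filter fun e => ¬ r e) x = mdeg p q C x :=
  Finset.sum_filter_add_sum_filter_not C r _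

/-- Double counting of incidences. With h = 1 it is the handshake lemma; with h the degree itself it
turns the sum of squared degrees into a sum over edges. -/
lemma sum_mdeg_mul [Fintype X] (h : X → ℝ) :
    ∑ x, mdeg p q C x * h x = ∑ e ∈ C, (h (p e) + h (q e)) := by
  simp only [mdeg, Finset.sum_mul]
  rw [Finset.sum_comm]
  refine Finset.sum_congr rfl fun e _ => ?_
  simp [add_mul, Finset.sum_add_distrib]

lemma sum_mdeg [Fintype X] : ∑ x, mdeg p q C x = 2 * (C.card : ℝ) := by
  have := sum_mdeg_mul (p := p) (q := q) (C := C) (fun _ => (1 : ℝ))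
  simp only [mul_one, Finset.sum_const, nsmul_eq_mul] at this
  rw [this]; ring

lemma mdeg_eq_card (hpq : ∀ e ∈ C, p e ≠ q e) (x : X) :
    mdeg p q C x = ((C.filter fun e => p e = x ∨ q e = x).card : ℝ) := by
  rw [mdeg, Finset.card_filter, Nat.cast_sum]
  refine Finset.sum_congr rfl fun e he => ?_
  have := hpq e he
  by_cases h1 : p e = x <;> by_cases h2 : q e = x <;> simp [h1, h2]
  exact this (h1.trans h2.symm)

lemma mdeg_le_card (hpq : ∀ e ∈ C, p e ≠ q e) (x : X) : mdeg p q C x ≤ C.card := by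
  rw [mdeg_eq_card hpq]
  exact_mod_cast Finset.card_filter_le _ _

/-- If vertices outside `A` have few edges that touch `A`, then the sum of squared degrees is
governed by the vertices in `A` and the edges that avoid `A`. -/
lemma sum_sq_mdeg_le [Fintype X] (A : Finset X) {B Δ : ℝ}
    (hB : ∀ x, x ∉ A → mdeg p q (C.filter fun e => p e ∈ A ∨ q e ∈ A) x ≤ B)
    (hΔ : ∀ x, x ∉ A → mdeg p q C x ≤ Δ) (hB0 : 0 ≤ B) (hΔ0 : 0 ≤ Δ) :
    ∑ x, mdeg p q C x ^ 2 ≤ ∑ x ∈ A, mdeg p q C x ^ 2 + 2 * B * C.card +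
      2 * Δ * ((C.filter fun e => ¬ (p e ∈ A ∨ q e ∈ A)).card : ℝ) := by
  classical
  rw [← Finset.sum_add_sum_compl A, add_assoc]
  gcongr
  have key : ∀ x ∈ Aᶜ, mdeg p q C x ^ 2 ≤ B * mdeg p q C x +
      Δ * mdeg p q (C.filter fun e => ¬ (p e ∈ A ∨ q e ∈ A)) x := by
    intro x hx
    have hx' : x ∉ A := by simpa using hx
    have h1 := hB x hx'
    have h2 := hΔ x hx'
    have h3 := mdeg_filter_add (p := p) (q := q) (C := C) (fun e => p e ∈ A ∨ q e ∈ A) x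
    have h4 := mdeg_nonneg (p := p) (q := q) (C := C) x
    have h5 := mdeg_nonneg (p := p) (q := q) (C := C.filter fun e => ¬ (p e ∈ A ∨ q e ∈ A)) x
    -- Only one of the two factors is split by whether the edge touches A. The touching part is at
    -- most B, and next to the other part the full degree is at most Δ.
    calc mdeg p q C x ^ 2 = mdeg p q (C.filter fun e => p e ∈ A ∨ q e ∈ A) x * mdeg p q C x +
          mdeg p q C x * mdeg p q (C.filter fun e => ¬ (p e ∈ A ∨ q e ∈ A)) x := by
            rw [← h3]; ring
      _ ≤ _ := by gcongr
  refine (Finset.sum_le_sum key).trans ?_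
  rw [Finset.sum_add_distrib, ← Finset.mul_sum, ← Finset.mul_sum]
  have e1 : ∑ x ∈ Aᶜ, mdeg p q C x ≤ 2 * (C.card : ℝ) := by
    rw [← sum_mdeg (p := p) (q := q) (C := C)]
    exact Finset.sum_le_sum_of_subset_of_nonneg (Finset.subset_univ _) fun x _ _ => mdeg_nonneg x
  have e2 : ∑ x ∈ Aᶜ, mdeg p q (C.filter fun e => ¬ (p e ∈ A ∨ q e ∈ A)) x ≤
      2 * ((C.filter fun e => ¬ (p e ∈ A ∨ q e ∈ A)).card : ℝ) := by
    rw [← sum_mdeg (p := p) (q := q)]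
    exact Finset.sum_le_sum_of_subset_of_nonneg (Finset.subset_univ _) fun x _ _ => mdeg_nonneg x
  calc _ ≤ B * (2 * (C.card : ℝ)) +
      Δ * (2 * ((C.filter fun e => ¬ (p e ∈ A ∨ q e ∈ A)).card : ℝ)) := by gcongr
    _ = _ := by ring

lemma sum_sq_mdeg_le_max [Fintype X] {M : ℝ} (hM : ∀ x, mdeg p q C x ≤ M) :
    ∑ x, mdeg p q C x ^ 2 ≤ 2 * M * C.card := by
  calc ∑ x, mdeg p q C x ^ 2 ≤ ∑ x, M * mdeg p q C x := by
        refine Finset.sum_le_sum fun x _ => ?_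
        rw [sq]
        exact mul_le_mul_of_nonneg_right (hM x) (mdeg_nonneg x)
    _ = _ := by rw [← Finset.mul_sum, sum_mdeg]; ring

/-- A bound on the sum of squared degrees for edge multiplicities at most `B`, in terms of the
number of edges that avoid the vertex `a`. -/
lemma sum_sq_mdeg_le_of_mult [Fintype X] (hpq : ∀ e ∈ C, p e ≠ q e) {B : ℝ} (a : X)
    (hB : ∀ x, x ≠ a → mdeg p q (C.filter fun e => p e = a ∨ q e = a) x ≤ B) (hB0 : 0 ≤ B)
    {y : ℝ} (hy : ((C.filter fun e => ¬ (p e = a ∨ q e = a)).card : ℝ) = y) :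
    ∑ x, mdeg p q C x ^ 2 ≤ (C.card - y) ^ 2 + 2 * B * C.card + 2 * (B + y) * y := by
  have hy0 : 0 ≤ y := by rw [← hy]; positivity
  have hd : mdeg p q C a = C.card - y := by
    rw [mdeg_eq_card hpq, ← hy, eq_sub_iff_add_eq]
    exact_mod_cast Finset.card_filter_add_card_filter_not (s := C) (fun e => p e = a ∨ q e = a)
  -- A vertex other than a has at most B incidences with edges at a and at most y with the remaining
  -- edges, hence Δ = B + y.
  have := sum_sq_mdeg_le (p := p) (q := q) (C := C) {a} (B := B) (Δ := B + y)
    (by simpa using hB) (by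
      intro x hx
      have hx' : x ≠ a := by simpa using hx
      rw [← mdeg_filter_add (fun e => p e = a ∨ q e = a)]
      refine add_le_add (hB x hx') ?_
      rw [← hy]
      exact mdeg_le_card (fun e he => hpq e (Finset.mem_of_mem_filter e he)) x) hB0 (by positivity)
  simp only [Finset.mem_singleton, Finset.sum_singleton, hy, hd] at this
  exact this

end Mdeg

lemma indicator_pair_le {V : Type*} [DecidableEq V] {x y u v : V} (hxy : x ≠ y) (huv : u ≠ v)
    (h1 : ¬ (x = u ∧ y = v)) (h2 : ¬ (x = v ∧ y = u)) :
    ((if x = u then 1 else 0) + (if y = u then 1 else 0) +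
      ((if x = v then 1 else 0) + (if y = v then 1 else 0)) : ℝ) ≤ 1 := by
  split_ifs <;> first | (norm_num; done) | grind

/-- The sum of squared degrees of a simple graph with few edges and bounded degrees. -/
lemma sum_sq_mdeg_le_of_few_edges {V : Type*} [Fintype V] [DecidableEq V] {C : Finset (V × V)}
    (hloop : ∀ e ∈ C, e.1 ≠ e.2)
    (hsimple : ∀ e ∈ C, ∀ f ∈ C, s(e.1, e.2) = s(f.1, f.2) → e = f) {d η K : ℝ} (hη : 0 < η)
    (hd : 0 < d) (hdeg : ∀ v, mdeg Prod.fst Prod.snd C v ≤ d) (hC : (C.card : ℝ) ≤ K * d) :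
    ∑ v, mdeg Prod.fst Prod.snd C v ^ 2 ≤
      C.card * ((1 + η) * d + 2 * (2 * K / η) ^ 2) := by
  set D := mdeg (Prod.fst : V × V → V) Prod.snd C with hD
  set m : ℝ := (C.card : ℝ) with hm
  -- The heavy vertices. The degree sum 2m ≤ 2Kd leaves room for at most 2K/η of them, so at most
  -- (2K/η)² edges have two heavy ends; every other edge has degree sum at most (1 + η)d.
  set H : Finset V := Finset.univ.filter fun v => η * d ≤ D v with hH
  have hHcard : (H.card : ℝ) ≤ 2 * K / η := by
    have h1 : (H.card : ℝ) * (η * d) ≤ 2 * m := by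
      rw [hm, ← sum_mdeg (p := (Prod.fst : V × V → V)) (q := Prod.snd)]
      calc (H.card : ℝ) * (η * d) = ∑ v ∈ H, η * d := by simp
        _ ≤ ∑ v ∈ H, D v := Finset.sum_le_sum fun v hv => by simpa [hH] using hv
        _ ≤ ∑ v, D v :=
          Finset.sum_le_sum_of_subset_of_nonneg (Finset.subset_univ _) fun x _ _ => mdeg_nonneg x
    rw [le_div_iff₀ hη]
    have : (H.card : ℝ) * η * d ≤ 2 * K * d := by nlinarith
    exact le_of_mul_le_mul_right this hd
  -- Simplicity enters here: an edge other than e contains at most one of the two ends of e, and e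
  -- itself is counted twice.
  have hpair : ∀ e ∈ C, D e.1 + D e.2 ≤ m + 1 := by
    intro e he
    have : D e.1 + D e.2 ≤ ∑ f ∈ C, ((1 : ℝ) + if f = e then 1 else 0) := by
      rw [hD, mdeg, mdeg, ← Finset.sum_add_distrib]
      refine Finset.sum_le_sum fun f hf => ?_
      by_cases hfe : f = e
      · subst hfe
        have := hloop f hf
        simp [this, this.symm]
      · have hl := hloop f hf
        have hl' := hloop e he
        have h1 : ¬ (f.1 = e.1 ∧ f.2 = e.2) := fun h => hfe (Prod.ext h.1 h.2)
        have h2 : ¬ (f.1 = e.2 ∧ f.2 = e.1) := fun h =>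
          hfe (hsimple f hf e he (by rw [h.1, h.2, Sym2.eq_swap]))
        rw [if_neg hfe, add_zero]
        exact indicator_pair_le hl hl' h1 h2
    refine this.trans ?_
    rw [Finset.sum_add_distrib]
    simp [he, hm]
  have hbig : ((C.filter fun e => e.1 ∈ H ∧ e.2 ∈ H).card : ℝ) ≤ (H.card : ℝ) ^ 2 := by
    have : (C.filter fun e => e.1 ∈ H ∧ e.2 ∈ H).card ≤ (H ×ˢ H).card :=
      Finset.card_le_card fun e he => by
        simp only [Finset.mem_filter] at he
        simpa using he.2
    rw [Finset.card_product] at this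
    rw [sq]; exact_mod_cast this
  have hsum : ∑ v, D v ^ 2 = ∑ e ∈ C, (D e.1 + D e.2) := by
    simp only [sq]
    exact sum_mdeg_mul (p := (Prod.fst : V × V → V)) (q := Prod.snd) D
  rw [hsum]
  have hm0 : 0 ≤ m := by positivity
  calc ∑ e ∈ C, (D e.1 + D e.2)
      ≤ ∑ e ∈ C, ((1 + η) * d + if e.1 ∈ H ∧ e.2 ∈ H then m + 1 else 0) := by
        refine Finset.sum_le_sum fun e he => ?_
        have h1 := hdeg e.1
        have h2 := hdeg e.2
        split_ifs with h
        · have := hpair e he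
          have : 0 < (1 + η) * d := by positivity
          linarith
        · rw [not_and_or] at h
          simp only [hH, Finset.mem_filter, Finset.mem_univ, true_and, not_le] at h
          rcases h with h | h <;> linarith
    _ = m * ((1 + η) * d) + ((C.filter fun e => e.1 ∈ H ∧ e.2 ∈ H).card : ℝ) * (m + 1) := by
        rw [Finset.sum_add_distrib, ← Finset.sum_filter]
        simp [hm, mul_add]
    _ ≤ m * ((1 + η) * d) + ((C.filter fun e => e.1 ∈ H ∧ e.2 ∈ H).card : ℝ) * (2 * m) := by
        rcases C.eq_empty_or_nonempty with hC0 | hC0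
        · simp [hC0]
        · have : 1 ≤ m := by
            rw [hm]; exact_mod_cast hC0.card_pos
          gcongr; linarith
    _ ≤ m * ((1 + η) * d) + (2 * K / η) ^ 2 * (2 * m) := by
        gcongr
        exact hbig.trans (by gcongr)
    _ = _ := by ring

/-! ### Savings of a cluster of coloured edges -/

/-- A set of oriented edges of a simple graph of maximum degree at most `d`, with endpoints of
different colours, such that any two colours are joined by at most `B` edges. -/
structure SpreadEdges {V Y : Type*} [DecidableEq V] [DecidableEq Y] (ρ : V → Y) (d B : ℝ)
    (C : Finset (V × V)) : Prop where
  bichromatic : ∀ e ∈ C, ρ e.1 ≠ ρ e.2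
  simple : ∀ e ∈ C, ∀ f ∈ C, s(e.1, e.2) = s(f.1, f.2) → e = f
  mdeg_le : ∀ v, mdeg Prod.fst Prod.snd C v ≤ d
  card_le : ∀ a c, a ≠ c →
    ((C.filter fun e => (ρ e.1 = a ∧ ρ e.2 = c) ∨ (ρ e.1 = c ∧ ρ e.2 = a)).card : ℝ) ≤ B

/-- The amount by which the cost of the cluster of edge points `C` falls below `4 |C|`. -/
noncomputable def savings {V Y : Type*} [Fintype V] [DecidableEq V] [Fintype Y] [DecidableEq Y]
    (ρ : V → Y) (C : Finset (V × V)) : ℝ :=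
  (∑ v, mdeg Prod.fst Prod.snd C v ^ 2 +
    ∑ c, mdeg (fun e => ρ e.1) (fun e => ρ e.2) C c ^ 2) / (C.card : ℝ)

/-- Each edge touching F contributes at least once to the degree sum over F, and twice if both its
ends lie there. -/
lemma card_touching_le_sum_mdeg {ι X : Type*} [Fintype X] [DecidableEq X] {p q : ι → X}
    {C : Finset ι} (F : Finset X) :
    ((C.filter fun e => p e ∈ F ∨ q e ∈ F).card : ℝ) ≤ ∑ x ∈ F, mdeg p q C x := by
  calc ((C.filter fun e => p e ∈ F ∨ q e ∈ F).card : ℝ)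
      ≤ ∑ e ∈ C, ((if p e ∈ F then (1 : ℝ) else 0) + if q e ∈ F then 1 else 0) := by
        rw [Finset.card_filter, Nat.cast_sum]
        refine Finset.sum_le_sum fun e _ => ?_
        by_cases h1 : p e ∈ F <;> by_cases h2 : q e ∈ F <;> simp [h1, h2]
    _ = ∑ x, mdeg p q C x * (if x ∈ F then 1 else 0) :=
        (sum_mdeg_mul fun x => if x ∈ F then (1 : ℝ) else 0).symm
    _ = _ := by simp

section Cluster

variable {V Y : Type*} [DecidableEq V] [DecidableEq Y]
  {ρ : V → Y} {d B η : ℝ} {C C' : Finset (V × V)}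

lemma SpreadEdges.mono (h : SpreadEdges ρ d B C) (hC : C' ⊆ C) : SpreadEdges ρ d B C' where
  bichromatic e he := h.bichromatic e (hC he)
  simple e he f hf := h.simple e (hC he) f (hC hf)
  mdeg_le v := (mdeg_mono hC v).trans (h.mdeg_le v)
  card_le a c hac := le_trans (by
    exact_mod_cast Finset.card_le_card (Finset.filter_subset_filter _ hC)) (h.card_le a c hac)

lemma SpreadEdges.colour_mdeg_le (h : SpreadEdges ρ d B C) {a c : Y} (hac : c ≠ a) :
    mdeg (fun e => ρ e.1) (fun e => ρ e.2) (C.filter fun e => ρ e.1 = a ∨ ρ e.2 = a) c ≤ B := by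
  rw [mdeg_eq_card fun e he => h.bichromatic e (Finset.mem_of_mem_filter e he), Finset.filter_filter]
  refine le_trans ?_ (h.card_le a c hac.symm)
  norm_cast
  refine Finset.card_le_card fun e he => ?_
  simp only [Finset.mem_filter] at he ⊢
  grind

/-- Transfers multiplicity bounds from colours to vertices: a vertex outside class a has at most as
many edges into that class as its whole colour has. -/
lemma mdeg_le_colour_mdeg (ρ : V → Y) (C : Finset (V × V)) (v : V) :
    mdeg Prod.fst Prod.snd C v ≤ mdeg (fun e => ρ e.1) (fun e => ρ e.2) C (ρ v) := by
  refine Finset.sum_le_sum fun e _ => ?_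
  gcongr <;> split_ifs <;> simp_all

/-- A bichromatic edge has at most one end of colour a, so there is no factor 2. -/
lemma SpreadEdges.sum_colour_class_mdeg_le [Fintype V] (h : SpreadEdges ρ d B C) (a : Y) :
    ∑ v with ρ v = a, mdeg Prod.fst Prod.snd C v ≤ C.card := by
  calc ∑ v with ρ v = a, mdeg Prod.fst Prod.snd C v
      = ∑ v, mdeg Prod.fst Prod.snd C v * (if ρ v = a then 1 else 0) := by
        rw [Finset.sum_filter]; simp
    _ = ∑ e ∈ C, ((if ρ e.1 = a then (1 : ℝ) else 0) + if ρ e.2 = a then 1 else 0) :=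
        sum_mdeg_mul _
    _ ≤ C.card := (mdeg_le_card (p := fun e : V × V => ρ e.1) (q := fun e => ρ e.2)
        h.bichromatic a)

/-- The savings of a cluster exceed its size by at most about `d`. Unless the cluster is small,
near equality forces nearly all edges to meet one colour class, in vertices of high degree. -/
lemma SpreadEdges.savings_cases [Fintype V] [Fintype Y] (h : SpreadEdges ρ d (η * d) C) (hη : 0 < η)
    (hd : 0 < d) (hdη : 2 * (200 / η) ^ 2 ≤ η * d) {x : ℝ}
    (hx : x = (1 + 6 * η) * d - (savings ρ C - C.card)) :
    0 ≤ x ∧ ((C.card : ℝ) ≤ 100 * d ∨ (C.card : ℝ) ≤ 10 * x ∨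
      ∃ a, ((C.filter fun e => ¬ (ρ e.1 = a ∨ ρ e.2 = a)).card : ℝ) ≤ x ∧
        (d - x) * C.card ≤ ∑ v with ρ v = a, mdeg Prod.fst Prod.snd C v ^ 2) := by
  have hηd : 0 < η * d := by positivity
  rcases C.eq_empty_or_nonempty with hC0 | hC0
  · subst hC0
    -- Division by zero gives the empty cluster savings 0, so its shortfall is the full (1 + 6η)d.
    simp only [savings, Finset.card_empty, Nat.cast_zero, div_zero, sub_zero] at hx
    exact ⟨by rw [hx]; positivity, Or.inl (by simp; positivity)⟩
  obtain ⟨e₀, he₀⟩ := hC0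
  have : Nonempty Y := ⟨ρ e₀.1⟩
  obtain ⟨a, ha⟩ := Finite.exists_max fun c => mdeg (fun e => ρ e.1) (fun e => ρ e.2) C c
  set m : ℝ := (C.card : ℝ) with hm
  have hm1 : 0 < m := by
    rw [hm]; exact_mod_cast Finset.card_pos.mpr ⟨e₀, he₀⟩
  set Q := ∑ c, mdeg (fun e => ρ e.1) (fun e => ρ e.2) C c ^ 2 with hQ
  set W := ∑ v, mdeg Prod.fst Prod.snd C v ^ 2 with hW
  set y : ℝ := ((C.filter fun e => ¬ (ρ e.1 = a ∨ ρ e.2 = a)).card : ℝ) with hy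
  set T := ∑ v with ρ v = a, mdeg Prod.fst Prod.snd C v ^ 2 with hT
  have hy0 : 0 ≤ y := by positivity
  have hym : y ≤ m := by
    rw [hy, hm]; exact_mod_cast Finset.card_filter_le _ _
  -- Here y counts the edges that avoid the colour a of largest degree. This bound serves for y ≤
  -- 6m/10; for larger y, every colour degree is at most m - y and `hQ2` takes over.
  have hQ1 : Q ≤ (m - y) ^ 2 + 2 * (η * d) * m + 2 * (η * d + y) * y :=
    sum_sq_mdeg_le_of_mult h.bichromatic a (fun c hc => h.colour_mdeg_le hc) hηd.le hy.symm
  have hda : mdeg (fun e => ρ e.1) (fun e => ρ e.2) C a = m - y := by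
    rw [mdeg_eq_card h.bichromatic, hy, eq_sub_iff_add_eq, hm]
    exact_mod_cast Finset.card_filter_add_card_filter_not (s := C)
      (fun e => ρ e.1 = a ∨ ρ e.2 = a)
  have hQ2 : Q ≤ 2 * (m - y) * m := sum_sq_mdeg_le_max fun c => (ha c).trans hda.le
  have hW1 : W ≤ 2 * d * m := sum_sq_mdeg_le_max h.mdeg_le
  -- A vertex outside the class of a has at most ηd edges into that class, so its contribution is
  -- negligible apart from the y edges avoiding a.
  have hW2 : W ≤ T + 2 * (η * d) * m + 2 * d * y := by
    have := sum_sq_mdeg_le (p := Prod.fst) (q := Prod.snd) (C := C)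
      (Finset.univ.filter fun v => ρ v = a) (B := η * d) (Δ := d) (by
        intro v hv
        simp only [Finset.mem_filter, Finset.mem_univ, true_and] at hv ⊢
        exact (mdeg_le_colour_mdeg ρ _ v).trans (h.colour_mdeg_le hv))
      (fun v _ => h.mdeg_le v) hηd.le hd.le
    simpa only [Finset.mem_filter, Finset.mem_univ, true_and] using this
  have hTm : T ≤ d * m := by
    have h1 : T ≤ ∑ v with ρ v = a, d * mdeg Prod.fst Prod.snd C v :=
      Finset.sum_le_sum fun v _ => by
        rw [sq]; exact mul_le_mul_of_nonneg_right (h.mdeg_le v) (mdeg_nonneg v)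
    rw [← Finset.mul_sum] at h1
    refine h1.trans (mul_le_mul_of_nonneg_left ?_ hd.le)
    exact h.sum_colour_class_mdeg_le a
  have hsav : savings ρ C * m = Q + W := by
    rw [savings, ← hm, div_mul_cancel₀ _ hm1.ne', add_comm]
  have hxm : x * m = (1 + 6 * η) * d * m + m * m - (Q + W) := by
    rw [hx, ← hsav]; ring
  have hBy : η * d * y ≤ η * d * m := by gcongr
  by_cases hsmall : m ≤ 100 * d
  · refine ⟨?_, Or.inl hsmall⟩
    -- For at most 100d edges simplicity replaces the trivial W ≤ 2dm by nearly dm. The errors 4ηd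
    -- from Q and 2ηd from W make up the 6η.
    have hW3 : W ≤ m * ((1 + η) * d + 2 * (2 * 100 / η) ^ 2) :=
      sum_sq_mdeg_le_of_few_edges (fun e he h' => h.bichromatic e he (by rw [h'])) h.simple hη hd
        h.mdeg_le hsmall
    have hW4 : W ≤ m * ((1 + η) * d + η * d) := by
      refine hW3.trans ?_
      have : 2 * (2 * 100 / η) ^ 2 ≤ η * d := by convert hdη using 3; norm_num
      gcongr
    have hQ3 : Q ≤ m * m + 4 * (η * d) * m := by
      by_cases hy6 : y ≤ 6 / 10 * m
      · nlinarith [mul_nonneg hy0 (by linarith : 0 ≤ 2 * m - 3 * y)]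
      · push Not at hy6
        nlinarith [mul_nonneg hηd.le hm1.le]
    have : 0 ≤ x * m := by rw [hxm]; nlinarith
    exact nonneg_of_mul_nonneg_left this hm1
  push Not at hsmall
  by_cases hy1 : 1 / 10 * m ≤ y
  · have hQ3 : Q ≤ 88 / 100 * (m * m) + 4 * (η * d) * m := by
      by_cases hy6 : y ≤ 6 / 10 * m
      · nlinarith [mul_nonneg (by linarith : 0 ≤ y - 1 / 10 * m) (by linarith : 0 ≤ 6 / 10 * m - y)]
      · push Not at hy6
        nlinarith [mul_nonneg hηd.le hm1.le]
    have hx1 : 1 / 10 * m ≤ x := by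
      refine le_of_mul_le_mul_right ?_ hm1
      rw [hxm]
      nlinarith [mul_nonneg hηd.le hm1.le, mul_nonneg (by linarith : 0 ≤ m - 100 * d) hm1.le]
    exact ⟨by linarith, Or.inr (Or.inl (by linarith))⟩
  · push Not at hy1
    -- The two losses, dm - T from vertices of low degree and ym from edges avoiding a, are both
    -- nonnegative, so each is bounded by xm. The leftover y(m - 3y - 2d) is nonnegative since y <
    -- m/10 and m > 100d.
    have hkey : d * m - T + y * m ≤ x * m := by
      rw [hxm]
      have hz : 0 ≤ y * (m - 3 * y - 2 * d) := mul_nonneg hy0 (by linarith)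
      linarith [hQ1, hW2, hBy, hz]
    have hyx : y ≤ x := le_of_mul_le_mul_right (by linarith) hm1
    exact ⟨hy0.trans hyx, Or.inr (Or.inr ⟨a, hyx, by linarith [mul_nonneg hy0 hm1.le]⟩)⟩

/-- A set of vertices and at most one colour that meet most edges of a cluster; the vertices have
nearly full degree in the cluster, and a colour is only needed if the savings are small. -/
lemma SpreadEdges.exists_cover [Fintype V] [Fintype Y] (h : SpreadEdges ρ d (η * d) C)
    (hη : 0 < η) (hd : 0 < d) (hdη : 2 * (200 / η) ^ 2 ≤ η * d) {δ : ℝ} (hδ0 : 0 < δ)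
    {x : ℝ} (hx : x = (1 + 6 * η) * d - (savings ρ C - C.card)) :
    ∃ (S : Finset V) (Z : Finset Y), S.card * ((1 - δ / 10) * d) ≤ C.card ∧
      Z.card * (δ ^ 3 * d) ≤ x ∧
      ((C.filter fun e => ¬ (e.1 ∈ S ∨ e.2 ∈ S) ∧ ¬ (ρ e.1 ∈ Z ∨ ρ e.2 ∈ Z)).card : ℝ) ≤
        100 * d + 10 * x + 10 * δ ^ 2 * C.card := by
  obtain ⟨hx0, hcases⟩ := h.savings_cases hη hd hdη hx
  have hm0 : (0 : ℝ) ≤ C.card := by positivity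
  have hδm : 0 ≤ 10 * δ ^ 2 * (C.card : ℝ) := by positivity
  have hsub : ∀ (r : V × V → Prop) [DecidablePred r], ((C.filter r).card : ℝ) ≤ C.card :=
    fun r _ => by exact_mod_cast Finset.card_filter_le _ _
  rcases hcases with hm | hm | ⟨a, hy, hT⟩
  · exact ⟨∅, ∅, by simp, by simpa using hx0, (hsub _).trans (by linarith)⟩
  · exact ⟨∅, ∅, by simp, by simpa using hx0, (hsub _).trans (by linarith)⟩
  -- A large shortfall pays for taking the whole colour class a. Otherwise individual vertices must
  -- do, and the shortfall is too small to allow much degree in light vertices.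
  by_cases hxδ : δ ^ 3 * d ≤ x
  · refine ⟨∅, {a}, by simp, by simpa using hxδ, ?_⟩
    simp only [Finset.notMem_empty, or_self, not_false_eq_true, true_and, Finset.mem_singleton]
    linarith
  push Not at hxδ
  set D := mdeg (Prod.fst : V × V → V) Prod.snd C with hD
  set S : Finset V := Finset.univ.filter fun v => ρ v = a ∧ (1 - δ / 10) * d ≤ D v with hS
  set F : Finset V := Finset.univ.filter fun v => ρ v = a ∧ ¬ (1 - δ / 10) * d ≤ D v with hF
  have hsplit : ∀ f : V → ℝ, ∑ v with ρ v = a, f v = ∑ v ∈ S, f v + ∑ v ∈ F, f v := fun f => by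
    rw [hS, hF, ← Finset.filter_filter, ← Finset.filter_filter,
      Finset.sum_filter_add_sum_filter_not]
  have hVa := h.sum_colour_class_mdeg_le a
  rw [← hD, hsplit] at hVa
  rw [hsplit] at hT
  have hSF : 0 ≤ ∑ v ∈ F, D v := Finset.sum_nonneg fun v _ => mdeg_nonneg v
  refine ⟨S, ∅, ?_, by simpa using hx0, ?_⟩
  · calc S.card * ((1 - δ / 10) * d) = ∑ v ∈ S, (1 - δ / 10) * d := by simp
      _ ≤ ∑ v ∈ S, D v := Finset.sum_le_sum fun v hv => by
          simp only [hS, Finset.mem_filter] at hv; exact hv.2.2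
      _ ≤ C.card := by linarith
  have hTS : ∑ v ∈ S, D v ^ 2 ≤ d * ∑ v ∈ S, D v := by
    rw [Finset.mul_sum]
    refine Finset.sum_le_sum fun v _ => ?_
    rw [sq]; exact mul_le_mul_of_nonneg_right (h.mdeg_le v) (mdeg_nonneg v)
  have hTF : ∑ v ∈ F, D v ^ 2 ≤ (1 - δ / 10) * d * ∑ v ∈ F, D v := by
    rw [Finset.mul_sum]
    refine Finset.sum_le_sum fun v hv => ?_
    simp only [hF, Finset.mem_filter, not_le] at hv
    rw [sq]; exact mul_le_mul_of_nonneg_right hv.2.2.le (mdeg_nonneg v)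
  have hq : ∑ v ∈ F, D v ≤ 10 * δ ^ 2 * C.card := by
    -- Each unit of degree in a light vertex loses at least δd/10 in T against its maximum d|C|,
    -- while T falls short of this by at most x|C|.
    have h1 : δ / 10 * d * ∑ v ∈ F, D v ≤ x * C.card := by
      nlinarith [mul_le_mul_of_nonneg_left hVa hd.le]
    have h2 : x * C.card ≤ δ ^ 3 * d * C.card := by gcongr
    refine le_of_mul_le_mul_left ?_ (by positivity : 0 < δ / 10 * d)
    calc _ ≤ δ ^ 3 * d * C.card := h1.trans h2
      _ = _ := by ring
  have hcount := card_touching_le_sum_mdeg (p := Prod.fst) (q := Prod.snd) (C := C) F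
  have hun : ((C.filter fun e => ¬ (e.1 ∈ S ∨ e.2 ∈ S) ∧
      ¬ (ρ e.1 ∈ (∅ : Finset Y) ∨ ρ e.2 ∈ (∅ : Finset Y))).card : ℝ) ≤
      ((C.filter fun e => ¬ (ρ e.1 = a ∨ ρ e.2 = a)).card : ℝ) +
        ((C.filter fun e => e.1 ∈ F ∨ e.2 ∈ F).card : ℝ) := by
    norm_cast
    refine (Finset.card_le_card ?_).trans (Finset.card_union_le _ _)
    intro e he
    simp only [Finset.mem_filter, Finset.mem_union, hS, hF, Finset.mem_univ, true_and] at he ⊢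
    tauto
  linarith

end Cluster

/-! ### Clusterings with large savings yield vertex covers -/

/-- The size of a union of colour classes, if the class sizes have small variance. -/
lemma sum_class_le_of_sum_sq_le {Y : Type*} [Fintype Y] {z : Y → ℝ} {n : ℝ}
    (hn : 0 < n) (hY : 0 < Fintype.card Y) (hsum : ∑ c, z c = n)
    (hvar : ∑ c, z c ^ 2 ≤ n ^ 2 / Fintype.card Y + 100 * n) (Z : Finset Y) :
    ∑ c ∈ Z, z c ≤ 2 * Z.card * (n / Fintype.card Y) + 25 * Fintype.card Y := by
  set k : ℝ := (Fintype.card Y : ℝ) with hk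
  have hk0 : 0 < k := by rw [hk]; exact_mod_cast hY
  set θ := n / k with hθ
  have hθ0 : 0 < θ := by positivity
  have hθk : θ * k = n := by rw [hθ]; field_simp
  -- The AM-GM inequality z - θ ≤ θ + (z - θ)²/(4θ). The total squared deviation 100n from the mean
  -- θ = n/k becomes 25k.
  have h1 : ∀ c, z c ≤ 2 * θ + (z c - θ) ^ 2 / (4 * θ) := fun c => by
    have : 0 ≤ (z c - θ - 2 * θ) ^ 2 / (4 * θ) := by positivity
    have e : (z c - θ - 2 * θ) ^ 2 / (4 * θ) = (z c - θ) ^ 2 / (4 * θ) - (z c - θ) + θ := by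
      field_simp; ring
    linarith
  have h2 : ∑ c, (z c - θ) ^ 2 ≤ 100 * n := by
    have : ∑ c, (z c - θ) ^ 2 = ∑ c, z c ^ 2 - 2 * θ * ∑ c, z c + k * θ ^ 2 := by
      simp only [sub_sq, Finset.sum_add_distrib, Finset.sum_sub_distrib]
      rw [Finset.mul_sum]
      simp only [Finset.sum_const, Finset.card_univ, nsmul_eq_mul, ← hk]
      congr 2
      exact Finset.sum_congr rfl fun c _ => by ring
    rw [this, hsum]
    have e : n ^ 2 / k = θ * n := by rw [hθ]; ring
    have e2 : k * θ ^ 2 = θ * n := by rw [← hθk]; ring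
    rw [e] at hvar
    rw [e2]; linarith
  calc ∑ c ∈ Z, z c ≤ ∑ c ∈ Z, (2 * θ + (z c - θ) ^ 2 / (4 * θ)) :=
        Finset.sum_le_sum fun c _ => h1 c
    _ ≤ 2 * Z.card * θ + ∑ c, (z c - θ) ^ 2 / (4 * θ) := by
        rw [Finset.sum_add_distrib]
        refine add_le_add (by simp; linarith) ?_
        exact Finset.sum_le_sum_of_subset_of_nonneg (Finset.subset_univ _)
          fun c _ _ => by positivity
    _ ≤ 2 * Z.card * θ + 25 * k := by
        gcongr
        rw [← Finset.sum_div, div_le_iff₀ (by positivity)]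
        linarith

/-- If `S` is only slightly larger than half of the vertices of a graph with degrees at most `d`
and misses few edges, then some set of half of the vertices misses few edges. -/
lemma exists_half_cover {n : ℕ} {E : Finset (Fin n × Fin n)} {d a b : ℝ}
    (hd : ∀ v, mdeg Prod.fst Prod.snd E v ≤ d) (hd0 : 0 ≤ d) (S : Finset (Fin n))
    (hS : (S.card : ℝ) ≤ n / 2 + a) (ha : 0 ≤ a)
    (hmiss : ((E.filter fun e => ¬ (e.1 ∈ S ∨ e.2 ∈ S)).card : ℝ) ≤ b) :
    ∃ S' : Finset (Fin n), S'.card = n / 2 ∧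
      ((E.filter fun e => ¬ (e.1 ∈ S' ∨ e.2 ∈ S')).card : ℝ) ≤ b + d * (a + 1 / 2) := by
  rcases le_total S.card (n / 2) with h | h
  · obtain ⟨S', hSS, hS'⟩ := Finset.exists_superset_card_eq h (by simpa using Nat.div_le_self n 2)
    refine ⟨S', hS', ?_⟩
    have : ((E.filter fun e => ¬ (e.1 ∈ S' ∨ e.2 ∈ S')).card : ℝ) ≤
        ((E.filter fun e => ¬ (e.1 ∈ S ∨ e.2 ∈ S)).card : ℝ) := by
      norm_cast
      refine Finset.card_le_card fun e he => ?_
      simp only [Finset.mem_filter] at he ⊢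
      exact ⟨he.1, fun h => he.2 (h.imp (@hSS _) (@hSS _))⟩
    have : 0 ≤ d * (a + 1 / 2) := by positivity
    linarith
  · obtain ⟨S', hSS, hS'⟩ := Finset.exists_subset_card_eq h
    refine ⟨S', hS', ?_⟩
    have h1 : ((E.filter fun e => ¬ (e.1 ∈ S' ∨ e.2 ∈ S')).card : ℝ) ≤
        ((E.filter fun e => ¬ (e.1 ∈ S ∨ e.2 ∈ S)).card : ℝ) +
        ((E.filter fun e => e.1 ∈ S \ S' ∨ e.2 ∈ S \ S').card : ℝ) := by
      norm_cast
      refine (Finset.card_le_card ?_).trans (Finset.card_union_le _ _)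
      intro e he
      simp only [Finset.mem_filter, Finset.mem_union, Finset.mem_sdiff] at he ⊢
      tauto
    have h2 : ((E.filter fun e => e.1 ∈ S \ S' ∨ e.2 ∈ S \ S').card : ℝ) ≤
        d * (S \ S').card := by
      refine (card_touching_le_sum_mdeg (p := Prod.fst) (q := Prod.snd) _).trans ?_
      refine (Finset.sum_le_sum fun v _ => hd v).trans ?_
      simp [mul_comm]
    have h3 : ((S \ S').card : ℝ) ≤ a + 1 / 2 := by
      rw [Finset.card_sdiff_of_subset hSS, Nat.cast_sub (by omega), hS']
      have : (n : ℝ) ≤ 2 * ((n / 2 : ℕ) : ℝ) + 1 := by exact_mod_cast (by omega)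
      linarith
    have h4 := mul_le_mul_of_nonneg_left h3 hd0
    linarith

set_option maxHeartbeats 1000000 in
/-- If every half of the vertices misses a `δ` fraction of the edges, then the total savings of
any clustering are bounded. -/
theorem sum_savings_le {n k : ℕ} {ρ : Fin n → Fin k} {E : Finset (Fin n × Fin n)} {d η δ : ℝ}
    (hk0 : 0 < k) (hreg : ∀ v, mdeg Prod.fst Prod.snd E v = d)
    (hspread : SpreadEdges ρ d (η * d) (E.filter fun e => ρ e.1 ≠ ρ e.2))
    (hδ0 : 0 < δ) (hδ : δ ≤ 1 / 10 ^ 3) (hη : 0 < η) (hηδ : 7 * η ≤ δ ^ 5) (hd : 0 < d)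
    (hdη : 2 * (200 / η) ^ 2 ≤ η * d) (hn : 10 / δ ≤ n) (hk : k ≤ δ ^ 2 / 242 * n)
    (hmono : 3 * ((E.filter fun e => ¬ ρ e.1 ≠ ρ e.2).card : ℝ) ≤ η * (k * d))
    (hvar : ∑ c, ((Finset.univ.filter fun v => ρ v = c).card : ℝ) ^ 2 ≤ (n : ℝ) ^ 2 / k + 100 * n)
    (hS : ∀ S : Finset (Fin n), S.card = n / 2 →
      δ * E.card ≤ ((E.filter fun e => ¬ (e.1 ∈ S ∨ e.2 ∈ S)).card : ℝ))
    (g : Fin n × Fin n → Fin k) :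
    ∑ i, savings ρ ((E.filter fun e => ρ e.1 ≠ ρ e.2).filter fun e => g e = i) ≤
      ((E.filter fun e => ρ e.1 ≠ ρ e.2).card : ℝ) + (1 - δ ^ 5) * k * d -
        3 * ((E.filter fun e => ¬ ρ e.1 ≠ ρ e.2).card : ℝ) := by
  by_contra hcon
  rw [not_le] at hcon
  set P := E.filter fun e => ρ e.1 ≠ ρ e.2 with hP
  set μ : ℝ := ((E.filter fun e => ¬ ρ e.1 ≠ ρ e.2).card : ℝ) with hμ
  set C : Fin k → Finset (Fin n × Fin n) := fun i => P.filter fun e => g e = i with hC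
  set x : Fin k → ℝ := fun i => (1 + 6 * η) * d - (savings ρ (C i) - (C i).card) with hx
  have hn0 : (0 : ℝ) < n := lt_of_lt_of_le (by positivity) hn
  have hk0' : (0 : ℝ) < k := by exact_mod_cast hk0
  have hkd : 0 < k * d := by positivity
  have hE : 2 * (E.card : ℝ) = n * d := by
    rw [← sum_mdeg (p := Prod.fst) (q := Prod.snd)]
    simp [hreg]
  have hsumC : ∑ i, ((C i).card : ℝ) = P.card := by
    have := Finset.card_eq_sum_card_fiberwise (s := P) (t := Finset.univ) (f := g)
      (fun _ _ => Finset.mem_coe.mpr (Finset.mem_univ _))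
    rw [this]; push_cast; rfl
  have hPE : (P.card : ℝ) ≤ E.card := by
    rw [hP]; exact_mod_cast Finset.card_filter_le _ _
  -- The slack 6η in each shortfall and the monochromatic term 3μ ≤ ηkd add up to 7ηkd ≤ δ⁵kd; the
  -- assumed excess of savings contributes the other δ⁵kd.
  have hsumx : ∑ i, x i ≤ 2 * δ ^ 5 * (k * d) := by
    have : ∑ i, x i = k * ((1 + 6 * η) * d) - ((∑ i, savings ρ (C i)) - P.card) := by
      rw [← hsumC]
      simp only [hx, Finset.sum_sub_distrib]
      simp
    rw [this]
    have h7 : 7 * η * (k * d) ≤ δ ^ 5 * (k * d) := by gcongr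
    linarith
  choose S Z hSc hZc hun using fun i =>
    (hspread.mono (Finset.filter_subset (fun e => g e = i) P)).exists_cover hη hd hdη hδ0
      (x := x i) rfl
  set S₀ := Finset.univ.biUnion S with hS₀
  set Z₀ := Finset.univ.biUnion Z with hZ₀
  have hS₀c : (S₀.card : ℝ) * ((1 - δ / 10) * d) ≤ E.card := by
    have h1 : (S₀.card : ℝ) ≤ ∑ i, ((S i).card : ℝ) := by
      exact_mod_cast Finset.card_biUnion_le
    have h0 : 0 ≤ (1 - δ / 10) * d := mul_nonneg (by linarith) hd.le
    calc (S₀.card : ℝ) * ((1 - δ / 10) * d) ≤ (∑ i, ((S i).card : ℝ)) * ((1 - δ / 10) * d) := by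
          gcongr
      _ ≤ ∑ i, ((C i).card : ℝ) := by
          rw [Finset.sum_mul]
          exact Finset.sum_le_sum fun i _ => hSc i
      _ ≤ _ := by rw [hsumC]; exact hPE
  have hZ₀c : (Z₀.card : ℝ) ≤ 2 * δ ^ 2 * k := by
    have h1 : (Z₀.card : ℝ) ≤ ∑ i, ((Z i).card : ℝ) := by
      exact_mod_cast Finset.card_biUnion_le
    have h0 : 0 < δ ^ 3 * d := by positivity
    refine le_of_mul_le_mul_right ?_ h0
    calc (Z₀.card : ℝ) * (δ ^ 3 * d) ≤ (∑ i, ((Z i).card : ℝ)) * (δ ^ 3 * d) := by gcongr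
      _ ≤ ∑ i, x i := by
          rw [Finset.sum_mul]
          exact Finset.sum_le_sum fun i _ => hZc i
      _ ≤ _ := hsumx
      _ = _ := by ring
  -- At most 2δ²k colours are in `Z₀`. Near-equal class sizes give them at most 4δ²n + 25k vertices,
  -- and k is small compared with δ²n.
  have hVZ : ((Finset.univ.filter fun v => ρ v ∈ Z₀).card : ℝ) ≤ 5 * δ ^ 2 * n := by
    have h1 : ((Finset.univ.filter fun v => ρ v ∈ Z₀).card : ℝ) =
        ∑ c ∈ Z₀, ((Finset.univ.filter fun v => ρ v = c).card : ℝ) := by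
      have := Finset.card_eq_sum_card_fiberwise (s := Finset.univ.filter fun v => ρ v ∈ Z₀)
        (t := Z₀) (f := ρ) (fun v hv => by simpa using hv)
      rw [this]; push_cast
      refine Finset.sum_congr rfl fun c hc => ?_
      rw [Finset.filter_filter]
      congr 2
      ext v
      simp only [Finset.mem_filter, Finset.mem_univ, true_and]
      exact ⟨fun h => h.2, fun h => ⟨h ▸ hc, h⟩⟩
    have h2 : ∑ c, ((Finset.univ.filter fun v => ρ v = c).card : ℝ) = n := by
      have := Finset.card_eq_sum_card_fiberwise (s := (Finset.univ : Finset (Fin n)))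
        (t := (Finset.univ : Finset (Fin k))) (f := ρ)
        (fun _ _ => Finset.mem_coe.mpr (Finset.mem_univ _))
      rw [Finset.card_univ, Fintype.card_fin] at this
      conv_rhs => rw [this]
      push_cast; rfl
    have h3 := sum_class_le_of_sum_sq_le hn0 (by simpa using hk0) h2 (by simpa using hvar) Z₀
    rw [← h1, Fintype.card_fin] at h3
    have h4 : 2 * (Z₀.card : ℝ) * (n / k) ≤ 4 * δ ^ 2 * n := by
      calc 2 * (Z₀.card : ℝ) * (n / k) ≤ 2 * (2 * δ ^ 2 * k) * (n / k) := by gcongr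
        _ = _ := by field_simp; ring
    have h5 : 25 * (k : ℝ) ≤ 25 * (δ ^ 2 / 242 * n) := by gcongr
    have h6 : 0 ≤ δ ^ 2 * n := by positivity
    linarith
  have hmiss : ((E.filter fun e => ¬ (e.1 ∈ S₀ ∨ e.2 ∈ S₀)).card : ℝ) ≤
      21 * δ ^ 2 * E.card := by
    -- An edge missed by `S₀` is monochromatic, or touches a colour in `Z₀`, or is uncovered within
    -- its own cluster.
    have h1 : ((E.filter fun e => ¬ (e.1 ∈ S₀ ∨ e.2 ∈ S₀)).card : ℝ) ≤ μ +
        (((E.filter fun e => e.1 ∈ (Finset.univ.filter fun v => ρ v ∈ Z₀) ∨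
          e.2 ∈ (Finset.univ.filter fun v => ρ v ∈ Z₀)).card : ℝ) +
        ∑ i, (((C i).filter fun e => ¬ (e.1 ∈ S i ∨ e.2 ∈ S i) ∧
          ¬ (ρ e.1 ∈ Z i ∨ ρ e.2 ∈ Z i)).card : ℝ)) := by
      rw [hμ]
      norm_cast
      refine le_trans ?_ (add_le_add_right (add_le_add_right Finset.card_biUnion_le _) _)
      refine le_trans ?_ (add_le_add_right (Finset.card_union_le _ _) _)
      refine le_trans (Finset.card_le_card ?_) (Finset.card_union_le _ _)
      intro e he
      simp only [Finset.mem_filter, Finset.mem_union, Finset.mem_biUnion, Finset.mem_univ,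
        true_and, hS₀, hZ₀, hC, hP, not_or, not_exists, not_not] at he ⊢
      by_cases hbi : ρ e.1 = ρ e.2
      · exact Or.inl ⟨he.1, hbi⟩
      right
      by_cases hz : (∃ i, ρ e.1 ∈ Z i) ∨ ∃ i, ρ e.2 ∈ Z i
      · exact Or.inl ⟨he.1, hz⟩
      · push Not at hz
        exact Or.inr ⟨g e, ⟨⟨he.1, hbi⟩, rfl⟩, ⟨he.2.1 _, he.2.2 _⟩, hz.1 _, hz.2 _⟩
    have h2 : ((E.filter fun e => e.1 ∈ (Finset.univ.filter fun v => ρ v ∈ Z₀) ∨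
          e.2 ∈ (Finset.univ.filter fun v => ρ v ∈ Z₀)).card : ℝ) ≤ 10 * δ ^ 2 * E.card := by
      refine (card_touching_le_sum_mdeg (p := Prod.fst) (q := Prod.snd) _).trans ?_
      rw [Finset.sum_congr rfl fun v _ => hreg v, Finset.sum_const, nsmul_eq_mul]
      calc _ ≤ 5 * δ ^ 2 * n * d := by gcongr
        _ = 5 * δ ^ 2 * (n * d) := by ring
        _ = _ := by rw [← hE]; ring
    have h3 : ∑ i, (((C i).filter fun e => ¬ (e.1 ∈ S i ∨ e.2 ∈ S i) ∧
          ¬ (ρ e.1 ∈ Z i ∨ ρ e.2 ∈ Z i)).card : ℝ) ≤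
        100 * (k * d) + 20 * δ ^ 5 * (k * d) + 10 * δ ^ 2 * E.card := by
      have h0 : _ ≤ ∑ i, (100 * d + 10 * x i + 10 * δ ^ 2 * ((C i).card : ℝ)) :=
        Finset.sum_le_sum fun i _ => hun i
      refine h0.trans ?_
      rw [Finset.sum_add_distrib, Finset.sum_add_distrib, ← Finset.mul_sum, ← Finset.mul_sum,
        ← Finset.mul_sum, hsumC]
      simp only [Finset.sum_const, Finset.card_univ, Fintype.card_fin, nsmul_eq_mul]
      have : 10 * δ ^ 2 * (P.card : ℝ) ≤ 10 * δ ^ 2 * E.card := by gcongr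
      linarith
    have hδ5 : δ ^ 5 ≤ 1 / 100 := by
      calc δ ^ 5 ≤ (1 / 10 ^ 3) ^ 5 := by gcongr
        _ ≤ _ := by norm_num
    have h4 : k * d ≤ δ ^ 2 / 242 * (2 * E.card) := by
      rw [hE]
      calc k * d ≤ (δ ^ 2 / 242 * n) * d := by gcongr
        _ = _ := by ring
    have h5 : δ ^ 5 * (k * d) ≤ 1 / 100 * (k * d) := by gcongr
    have h6 : 7 * η * (k * d) ≤ δ ^ 5 * (k * d) := by gcongr
    linarith
  have hS₀n : (S₀.card : ℝ) ≤ n / 2 + δ / 18 * n := by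
    have h1 : (1 - δ / 10) * d * S₀.card ≤ (1 - δ / 10) * d * (n / 2 + δ / 18 * n) := by
      have h2 : (1 : ℝ) / 2 ≤ (1 - δ / 10) * (1 / 2 + δ / 18) := by
        have : 0 ≤ δ * (1 - δ) := mul_nonneg hδ0.le (by linarith)
        linarith
      have h3 := mul_le_mul_of_nonneg_right h2 (mul_pos hn0 hd).le
      calc (1 - δ / 10) * d * S₀.card = S₀.card * ((1 - δ / 10) * d) := by ring
        _ ≤ 1 / 2 * (n * d) := by linarith
        _ ≤ _ := h3
        _ = _ := by ring
    exact le_of_mul_le_mul_left h1 (mul_pos (by linarith) hd)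
  obtain ⟨S', hS', hmiss'⟩ := exists_half_cover (fun v => (hreg v).le) hd.le S₀ hS₀n
    (by positivity) hmiss
  have h1 := (hS S' hS').trans hmiss'
  have hE0 : (0 : ℝ) < E.card := by linarith [mul_pos hn0 hd]
  -- The loss from trimming, with the 1/2 from rounding n/2 absorbed by n ≥ 10/δ. In all, fewer than
  -- (21/1000 + 1/9 + 1/10)δ|E| + o < δ|E| edges are missed, where no further error term o is in
  -- fact needed.
  have h2 : d * (δ / 18 * n + 1 / 2) ≤ (δ / 9 + δ / 10) * E.card := by
    have : 10 ≤ n * δ := by rwa [div_le_iff₀ hδ0] at hn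
    have h3 := mul_le_mul_of_nonneg_right this hd.le
    have h4 : δ * (2 * (E.card : ℝ)) = δ * (n * d) := by rw [hE]
    linarith
  have h3 : 21 * δ ^ 2 * E.card ≤ 21 / 1000 * δ * E.card := by
    have : δ * δ * E.card ≤ δ * (1 / 10 ^ 3) * E.card := by gcongr
    linarith
  have : 0 < δ * E.card := by positivity
  linarith

/-! ### The cost of a clustering of edge points -/

lemma sum_indicator_pair_sub_sq {X : Type*} [Fintype X] [DecidableEq X] {p q : X} (hpq : p ≠ q)
    (h : X → ℝ) :
    ∑ x, (((if p = x then 1 else 0) + (if q = x then 1 else 0)) - h x) ^ 2 =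
      2 - 2 * (h p + h q) + ∑ x, h x ^ 2 := by
  have e : ∀ x, (((if p = x then 1 else 0) + (if q = x then 1 else 0)) - h x) ^ 2 =
      (if p = x then 1 - 2 * h x else 0) + (if q = x then 1 - 2 * h x else 0) + h x ^ 2 := by
    intro x
    by_cases h1 : p = x <;> by_cases h2 : q = x
    · exact absurd (h1.trans h2.symm) hpq
    all_goals simp [h1, h2] <;> ring
  simp only [e, Finset.sum_add_distrib, Finset.sum_ite_eq, Finset.mem_univ, if_true]
  ring

/-- One coordinate of the cluster cost: as p and q differ on every edge, the entries are 0 or 1, and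
the quadratic in t is minimal at the mean, degree over |C|. -/
lemma mdeg_sub_sq_div_le {ι X : Type*} [DecidableEq X] {p q : ι → X} {C : Finset ι}
    (hpq : ∀ e ∈ C, p e ≠ q e) (x : X) (t : ℝ) :
    mdeg p q C x - mdeg p q C x ^ 2 / C.card ≤
      ∑ e ∈ C, (((if p e = x then 1 else 0) + (if q e = x then 1 else 0)) - t) ^ 2 := by
  have h1 : ∑ e ∈ C, (((if p e = x then 1 else 0) + (if q e = x then 1 else 0)) - t) ^ 2 =
      mdeg p q C x - 2 * t * mdeg p q C x + C.card * t ^ 2 := by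
    have : (C.card : ℝ) * t ^ 2 = ∑ e ∈ C, t ^ 2 := by simp
    rw [mdeg, Finset.mul_sum, this, ← Finset.sum_sub_distrib, ← Finset.sum_add_distrib]
    refine Finset.sum_congr rfl fun e he => ?_
    by_cases h1 : p e = x <;> by_cases h2 : q e = x
    · exact absurd (h1.trans h2.symm) (hpq e he)
    all_goals simp [h1, h2] <;> ring
  rw [h1]
  rcases C.eq_empty_or_nonempty with rfl | hC
  · simp [mdeg]
  have hm : (0 : ℝ) < C.card := by exact_mod_cast hC.card_pos
  have : 0 ≤ (C.card * t - mdeg p q C x) ^ 2 / C.card := by positivity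
  have e : (C.card * t - mdeg p q C x) ^ 2 / C.card =
      C.card * t ^ 2 - 2 * t * mdeg p q C x + mdeg p q C x ^ 2 / C.card := by
    field_simp
    ring
  linarith

lemma dist_edgePoint_sq {n k : ℕ} (ρ : Fin n → Fin k) (u v : Fin n)
    (c : EuclideanSpace ℝ (Fin (n + k))) :
    dist (edgePoint (n + k) ρ u v) c ^ 2 =
      ∑ x, (((if u = x then 1 else 0) + (if v = x then 1 else 0)) - c (Fin.castAdd k x)) ^ 2 +
      ∑ b, (((if ρ u = b then 1 else 0) + (if ρ v = b then 1 else 0)) - c (Fin.natAdd n b)) ^ 2 := by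
  rw [EuclideanSpace.dist_eq, Real.sq_sqrt (by positivity), Fin.sum_univ_add]
  congr 1
  · refine Finset.sum_congr rfl fun x _ => ?_
    rw [Real.dist_eq, sq_abs]
    have h1 : ∀ i : Fin k, ¬ (x : ℕ) = n + i := fun i h => by have := x.2; omega
    simp only [edgePoint, Fin.val_castAdd, h1, if_false, add_zero, Fin.val_inj, eq_comm (a := x)]
  · refine Finset.sum_congr rfl fun b _ => ?_
    rw [Real.dist_eq, sq_abs]
    have h1 : ∀ i : Fin n, ¬ n + (b : ℕ) = i := fun i h => by have := i.2; omega
    simp only [edgePoint, Fin.val_natAdd, h1, if_false, zero_add, Nat.add_left_cancel_iff,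
      Fin.val_inj, eq_comm (a := b)]

lemma sum_dist_edgePoint_sq_ge {n k : ℕ} {ρ : Fin n → Fin k} {C : Finset (Fin n × Fin n)}
    (hC : ∀ e ∈ C, ρ e.1 ≠ ρ e.2) (c : EuclideanSpace ℝ (Fin (n + k))) :
    4 * C.card - savings ρ C ≤ ∑ e ∈ C, dist (edgePoint (n + k) ρ e.1 e.2) c ^ 2 := by
  simp only [dist_edgePoint_sq]
  rw [Finset.sum_add_distrib, Finset.sum_comm, Finset.sum_comm (s := C) (t := Finset.univ)]
  have h1 := Finset.sum_le_sum fun (x : Fin n) (_ : x ∈ Finset.univ) =>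
    mdeg_sub_sq_div_le (p := Prod.fst) (q := Prod.snd) (C := C)
      (fun e he h => hC e he (by rw [h])) x (c (Fin.castAdd k x))
  have h2 := Finset.sum_le_sum fun (b : Fin k) (_ : b ∈ Finset.univ) =>
    mdeg_sub_sq_div_le (p := fun e => ρ e.1) (q := fun e => ρ e.2) (C := C) hC b
      (c (Fin.natAdd n b))
  rw [Finset.sum_sub_distrib, sum_mdeg, ← Finset.sum_div] at h1 h2
  rw [savings, add_div]
  linarith

/-- Pulls the cost back from points to edges; injectivity ensures that no two edges merge into one
point. -/
lemma kmeansCost_image {ι : Type*} {D k : ℕ} {P : Finset ι}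
    {pt : ι → EuclideanSpace ℝ (Fin D)} (hinj : Set.InjOn pt P)
    [DecidableEq (EuclideanSpace ℝ (Fin D))] (f : EuclideanSpace ℝ (Fin D) → Fin k) :
    kmeansCost (P.image pt) f =
      ∑ i, ⨅ c : EuclideanSpace ℝ (Fin D), ∑ e ∈ P with f (pt e) = i, dist (pt e) c ^ 2 := by
  unfold kmeansCost
  refine Finset.sum_congr rfl fun i _ => ?_
  congr 1
  funext c
  rw [Finset.filter_image, Finset.sum_image]
  exact hinj.mono fun e he => Finset.mem_of_mem_filter e he

lemma sym2_eq_of_indicator_eq {X : Type*} [DecidableEq X] {p q u v : X} (hpq : p ≠ q)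
    (h : ∀ x, ((if p = x then 1 else 0) + (if q = x then 1 else 0) : ℝ) =
      (if u = x then 1 else 0) + (if v = x then 1 else 0)) : s(p, q) = s(u, v) := by
  have hmem : ∀ x, (p = x ∨ q = x) → (u = x ∨ v = x) := by
    intro x hx
    by_contra! hc
    have := h x
    rw [if_neg hc.1, if_neg hc.2] at this
    rcases hx with hx | hx <;> rw [if_pos hx] at this <;> split_ifs at this <;> norm_num at this
  rw [Sym2.eq_iff]
  rcases hmem p (Or.inl rfl) with h1 | h1 <;> rcases hmem q (Or.inr rfl) with h2 | h2
  · exact absurd (h1.symm.trans h2) hpq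
  · exact Or.inl ⟨h1.symm, h2.symm⟩
  · exact Or.inr ⟨h1.symm, h2.symm⟩
  · exact absurd (h1.symm.trans h2) hpq

lemma edgePoint_injOn {n k : ℕ} {ρ : Fin n → Fin k} {P : Finset (Fin n × Fin n)}
    (hloop : ∀ e ∈ P, e.1 ≠ e.2)
    (hsimple : ∀ e ∈ P, ∀ f ∈ P, s(e.1, e.2) = s(f.1, f.2) → e = f) :
    Set.InjOn (fun e : Fin n × Fin n => edgePoint (n + k) ρ e.1 e.2) P := by
  intro e he f hf h
  have hcoord : ∀ x : Fin n, ((if e.1 = x then 1 else 0) + (if e.2 = x then 1 else 0) : ℝ) =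
      (if f.1 = x then 1 else 0) + (if f.2 = x then 1 else 0) := by
    intro x
    have h0 : ∀ u v, edgePoint (n + k) ρ u v (Fin.castAdd k x) =
        (if u = x then 1 else 0) + (if v = x then 1 else 0) := fun u v => by
      have h1 : ∀ i : Fin k, ¬ (x : ℕ) = n + i := fun i h => by have := x.2; omega
      simp only [edgePoint, Fin.val_castAdd, h1, if_false, add_zero, Fin.val_inj, eq_comm (a := x)]
    rw [← h0, ← h0]
    exact congrArg (fun p => p (Fin.castAdd k x)) h
  exact hsimple e he f hf (sym2_eq_of_indicator_eq (hloop e he) hcoord)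

/-- The cost of a clustering in terms of the savings of its clusters. -/
lemma kmeansCost_ge {n k : ℕ} {ρ : Fin n → Fin k} {P : Finset (Fin n × Fin n)}
    (hP : ∀ e ∈ P, ρ e.1 ≠ ρ e.2)
    (hsimple : ∀ e ∈ P, ∀ f ∈ P, s(e.1, e.2) = s(f.1, f.2) → e = f)
    [DecidableEq (EuclideanSpace ℝ (Fin (n + k)))]
    (f : EuclideanSpace ℝ (Fin (n + k)) → Fin k) :
    4 * (P.card : ℝ) -
      ∑ i, savings ρ (P.filter fun e => f (edgePoint (n + k) ρ e.1 e.2) = i) ≤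
      kmeansCost (P.image fun e => edgePoint (n + k) ρ e.1 e.2) f := by
  rw [kmeansCost_image (edgePoint_injOn (fun e he h => hP e he (by rw [h])) hsimple)]
  have h1 : ∑ i, ((P.filter fun e => f (edgePoint (n + k) ρ e.1 e.2) = i).card : ℝ) = P.card := by
    have := Finset.card_eq_sum_card_fiberwise (s := P) (t := Finset.univ)
      (f := fun e => f (edgePoint (n + k) ρ e.1 e.2))
      (fun _ _ => Finset.mem_coe.mpr (Finset.mem_univ _))
    rw [this]; push_cast; rfl
  rw [← h1, Finset.mul_sum, ← Finset.sum_sub_distrib]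
  refine Finset.sum_le_sum fun i _ => le_ciInf fun c => ?_
  exact sum_dist_edgePoint_sq_ge (fun e he => hP e (Finset.mem_of_mem_filter e he)) c

/-- The clustering that sends each edge to the colour of a chosen endpoint, with centres that have
the weight `l` on the vertices in `S`. -/
lemma exists_kmeansCost_le {n k : ℕ} {ρ : Fin n → Fin k} {P : Finset (Fin n × Fin n)}
    (hP : ∀ e ∈ P, ρ e.1 ≠ ρ e.2) (hk : 0 < k)
    (hsimple : ∀ e ∈ P, ∀ f ∈ P, s(e.1, e.2) = s(f.1, f.2) → e = f)
    [DecidableEq (EuclideanSpace ℝ (Fin (n + k)))] (S : Finset (Fin n)) {l : ℝ} (hl : 0 ≤ l)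
    {r : Fin n × Fin n → Fin n} (hr : ∀ e ∈ P, r e = e.1 ∨ r e = e.2) :
    ∃ f : EuclideanSpace ℝ (Fin (n + k)) → Fin k,
      kmeansCost (P.image fun e => edgePoint (n + k) ρ e.1 e.2) f ≤
        3 * P.card - 2 * l * ((P.filter fun e => r e ∈ S).card : ℝ) +
        l ^ 2 * ∑ e ∈ P, ((S.filter fun v => ρ v = ρ (r e)).card : ℝ) := by
  classical
  have hinj := edgePoint_injOn (ρ := ρ) (fun e he h => hP e he (by rw [h])) hsimple
  set pt : Fin n × Fin n → EuclideanSpace ℝ (Fin (n + k)) :=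
    fun e => edgePoint (n + k) ρ e.1 e.2 with hpt
  -- A clustering must be a function of the point, so the edge is recovered from it by choice;
  -- injectivity makes the recovered edge the right one.
  let f : EuclideanSpace ℝ (Fin (n + k)) → Fin k := fun p =>
    if h : ∃ e ∈ P, pt e = p then ρ (r h.choose) else ⟨0, hk⟩
  have hf : ∀ e ∈ P, f (pt e) = ρ (r e) := by
    intro e he
    have h : ∃ e' ∈ P, pt e' = pt e := ⟨e, he, rfl⟩
    have : h.choose = e := hinj h.choose_spec.1 he h.choose_spec.2
    simp only [f, dif_pos h, this]
  refine ⟨f, ?_⟩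
  rw [kmeansCost_image hinj]
  let ctr : Fin k → EuclideanSpace ℝ (Fin (n + k)) := fun i =>
    WithLp.toLp 2 (Fin.append (fun v => if v ∈ S ∧ ρ v = i then l else 0)
      (fun b => if b = i then 1 else 0))
  have hpoint : ∀ e ∈ P, dist (pt e) (ctr (ρ (r e))) ^ 2 ≤
      3 - 2 * l * (if r e ∈ S then 1 else 0) +
        l ^ 2 * ((S.filter fun v => ρ v = ρ (r e)).card : ℝ) := by
    intro e he
    have hb := hP e he
    rw [hpt, dist_edgePoint_sq]
    simp only [ctr, Fin.append_left, Fin.append_right]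
    rw [sum_indicator_pair_sub_sq (fun h => hb (by rw [h])), sum_indicator_pair_sub_sq hb]
    have e1 : ∑ x, (if x ∈ S ∧ ρ x = ρ (r e) then l else 0) ^ 2 =
        l ^ 2 * ((S.filter fun v => ρ v = ρ (r e)).card : ℝ) := by
      have : ∀ x, (if x ∈ S ∧ ρ x = ρ (r e) then l else 0) ^ 2 =
          if x ∈ S ∧ ρ x = ρ (r e) then l ^ 2 else 0 := fun x => by split_ifs <;> simp
      simp only [this]
      rw [← Finset.sum_filter, Finset.sum_const, nsmul_eq_mul, mul_comm]
      congr 3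
      ext v; simp
    have e2 : ∑ x : Fin k, (if x = ρ (r e) then (1 : ℝ) else 0) ^ 2 = 1 := by simp
    rw [e1, e2]
    have e3 : l * (if r e ∈ S then 1 else 0) ≤ (if e.1 ∈ S ∧ ρ e.1 = ρ (r e) then l else 0) +
        (if e.2 ∈ S ∧ ρ e.2 = ρ (r e) then l else 0) := by
      have nn : ∀ (Q : Prop) [Decidable Q], 0 ≤ if Q then l else 0 := fun Q _ => by
        split_ifs <;> simp [hl]
      rcases hr e he with h | h
      · have := nn (e.2 ∈ S ∧ ρ e.2 = ρ (r e))
        rw [h] at this ⊢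
        simpa using this
      · have := nn (e.1 ∈ S ∧ ρ e.1 = ρ (r e))
        rw [h] at this ⊢
        simpa using this
    have e4 : (1 : ℝ) ≤ (if ρ e.1 = ρ (r e) then 1 else 0) +
        (if ρ e.2 = ρ (r e) then 1 else 0) := by
      rcases hr e he with h | h
      · rw [h, if_pos rfl]; split_ifs <;> norm_num
      · rw [h, if_pos (rfl : ρ e.2 = _)]; split_ifs <;> norm_num
    linarith
  have hsum : 3 * (P.card : ℝ) - 2 * l * ((P.filter fun e => r e ∈ S).card : ℝ) +
        l ^ 2 * ∑ e ∈ P, ((S.filter fun v => ρ v = ρ (r e)).card : ℝ) =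
      ∑ e ∈ P, (3 - 2 * l * (if r e ∈ S then 1 else 0) +
        l ^ 2 * ((S.filter fun v => ρ v = ρ (r e)).card : ℝ)) := by
    rw [Finset.sum_add_distrib, Finset.sum_sub_distrib, ← Finset.mul_sum, ← Finset.mul_sum,
      Finset.card_filter]
    push_cast
    simp [mul_comm]
  rw [hsum, ← Finset.sum_fiberwise P (fun e => f (pt e))]
  refine Finset.sum_le_sum fun i _ => (ciInf_le ⟨0, ?_⟩ (ctr i)).trans ?_
  · rintro _ ⟨c, rfl⟩
    positivity
  · refine Finset.sum_le_sum fun e he => ?_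
    simp only [Finset.mem_filter] at he
    have h2 := hf e he.1
    rw [he.2] at h2
    rw [h2]
    exact hpoint e he.1

/-! ### A cheap clustering from a vertex cover -/

lemma sum_sq_sub_mean_le {Y : Type*} [Fintype Y] {s : Y → ℝ} {σ : ℝ} (hY : 0 < Fintype.card Y)
    (hsum : ∑ i, s i = σ) (hvar : ∑ i, s i ^ 2 ≤ σ ^ 2 / Fintype.card Y + 100 * σ) :
    ∑ i, (s i - σ / Fintype.card Y) ^ 2 ≤ 100 * σ := by
  have hk0 : (0 : ℝ) < Fintype.card Y := by exact_mod_cast hY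
  have : ∑ i, (s i - σ / Fintype.card Y) ^ 2 = ∑ i, s i ^ 2 - σ ^ 2 / Fintype.card Y := by
    simp only [sub_sq, Finset.sum_add_distrib, Finset.sum_sub_distrib]
    rw [← Finset.sum_mul, ← Finset.mul_sum, hsum]
    simp only [Finset.sum_const, Finset.card_univ, nsmul_eq_mul]
    field_simp
    ring
  rw [this]; linarith

lemma sum_card_class {n k : ℕ} (ρ : Fin n → Fin k) (S : Finset (Fin n)) :
    ∑ c, ((S.filter fun v => ρ v = c).card : ℝ) = S.card := by
  have := Finset.card_eq_sum_card_fiberwise (s := S) (t := (Finset.univ : Finset (Fin k))) (f := ρ)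
    (fun _ _ => Finset.mem_coe.mpr (Finset.mem_univ _))
  conv_rhs => rw [this]
  push_cast; rfl

/-- The average size of `S`-classes, weighted by edges that are sent to an endpoint. -/
lemma sum_card_class_le {n k : ℕ} {ρ : Fin n → Fin k} {P : Finset (Fin n × Fin n)} {d ζ : ℝ}
    (hk : 0 < k) (hd : 0 < d) (hdeg : ∀ v, mdeg Prod.fst Prod.snd P v ≤ d) (hζ : 0 < ζ)
    (hζ1 : ζ ≤ 1) (hkn : k ≤ ζ ^ 2 / 1600 * n) (S : Finset (Fin n)) (hS : S.card = n / 2)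
    {r : Fin n × Fin n → Fin n} (hr : ∀ e ∈ P, r e = e.1 ∨ r e = e.2)
    (hun : ((P.filter fun e => ¬ r e ∈ S).card : ℝ) ≤ ζ * (n * d / 2))
    (hvarS : ∑ c, ((S.filter fun v => ρ v = c).card : ℝ) ^ 2 ≤
      (S.card : ℝ) ^ 2 / k + 100 * S.card)
    (hvar : ∑ c, ((Finset.univ.filter fun v => ρ v = c).card : ℝ) ^ 2 ≤
      (n : ℝ) ^ 2 / k + 100 * n) :
    ∑ e ∈ P, ((S.filter fun v => ρ v = ρ (r e)).card : ℝ) ≤ (1 + 4 * ζ) * (n ^ 2 * d / (4 * k)) := by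
  set s : Fin k → ℝ := fun c => ((S.filter fun v => ρ v = c).card : ℝ) with hs
  set U : Fin k → ℝ := fun c => (((P.filter fun e => ¬ r e ∈ S).filter
    fun e => ρ (r e) = c).card : ℝ) with hU
  set σ : ℝ := (S.card : ℝ) with hσ
  have hk0 : (0 : ℝ) < k := by exact_mod_cast hk
  have hn0 : (0 : ℝ) < n := by
    by_contra h
    have : (n : ℝ) = 0 := le_antisymm (not_lt.mp h) (by positivity)
    rw [this] at hkn
    linarith
  have hσn : σ ≤ n / 2 := by
    rw [hσ, hS]; exact Nat.cast_div_le
  have hσ0 : 0 ≤ σ := by positivity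
  have htouch : ∀ (Q : Finset (Fin n × Fin n)) (F : Finset (Fin n)), Q ⊆ P →
      (∀ e ∈ Q, r e ∈ F) → (Q.card : ℝ) ≤ d * F.card := by
    intro Q F hQ hF
    have h1 : (Q.card : ℝ) ≤ ((P.filter fun e => e.1 ∈ F ∨ e.2 ∈ F).card : ℝ) := by
      norm_cast
      refine Finset.card_le_card fun e he => ?_
      rw [Finset.mem_filter]
      refine ⟨hQ he, ?_⟩
      rcases hr e (hQ he) with h | h
      · exact Or.inl (h ▸ hF e he)
      · exact Or.inr (h ▸ hF e he)
    refine h1.trans ((card_touching_le_sum_mdeg (p := Prod.fst) (q := Prod.snd) F).trans ?_)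
    refine (Finset.sum_le_sum fun v _ => hdeg v).trans ?_
    simp [mul_comm]
  have hfib : ∀ Q : Finset (Fin n × Fin n), ∑ e ∈ Q, s (ρ (r e)) =
      ∑ c, ((Q.filter fun e => ρ (r e) = c).card : ℝ) * s c := by
    intro Q
    rw [← Finset.sum_fiberwise Q (fun e => ρ (r e))]
    refine Finset.sum_congr rfl fun c _ => ?_
    rw [Finset.sum_congr rfl (g := fun _ => s c)
      (fun e he => by rw [(Finset.mem_filter.mp he).2])]
    simp
  -- At most d·s(c) edges are sent to a vertex of S of colour c, so the sum is at most d times the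
  -- sum of the squared class sizes.
  have hcov : ∑ e ∈ P with r e ∈ S, s (ρ (r e)) ≤ d * (σ ^ 2 / k + 100 * σ) := by
    rw [hfib]
    refine le_trans (Finset.sum_le_sum (g := fun c => d * s c ^ 2) fun c _ => ?_) ?_
    · have := htouch ((P.filter fun e => r e ∈ S).filter fun e => ρ (r e) = c)
        (S.filter fun v => ρ v = c) (fun e he => by simp only [Finset.mem_filter] at he; exact he.1.1)
        (fun e he => by simp only [Finset.mem_filter] at he ⊢; exact ⟨he.1.2, he.2⟩)
      calc _ ≤ d * s c * s c := by gcongr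
        _ = _ := by ring
    · rw [← Finset.mul_sum]
      gcongr
  have hUle : ∀ c, U c ≤ d * ((Finset.univ.filter fun v => ρ v = c).card : ℝ) := fun c =>
    htouch _ _ (fun e he => by simp only [Finset.mem_filter] at he; exact he.1.1)
      (fun e he => by simp only [Finset.mem_filter, Finset.mem_univ, true_and] at he ⊢; exact he.2)
  have hU2 : ∑ c, U c ^ 2 ≤ d ^ 2 * (n ^ 2 / k + 100 * n) := by
    refine le_trans (Finset.sum_le_sum (g := fun c => d ^ 2 *
      ((Finset.univ.filter fun v => ρ v = c).card : ℝ) ^ 2) fun c _ => ?_) ?_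
    · rw [← mul_pow]
      exact pow_le_pow_left₀ (by positivity) (hUle c) 2
    · rw [← Finset.mul_sum]
      gcongr
  have hUsum : ∑ c, U c = ((P.filter fun e => ¬ r e ∈ S).card : ℝ) := by
    have := Finset.card_eq_sum_card_fiberwise (s := P.filter fun e => ¬ r e ∈ S)
      (t := (Finset.univ : Finset (Fin k))) (f := fun e => ρ (r e))
      (fun _ _ => Finset.mem_coe.mpr (Finset.mem_univ _))
    rw [this]; push_cast; rfl
  have hdev : ∑ c, (s c - σ / k) ^ 2 ≤ 100 * σ := by
    have := sum_sq_sub_mean_le (s := s) (σ := σ) (by simpa using hk) (sum_card_class ρ S)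
      (by simpa using hvarS)
    simpa using this
  have hunc : ∑ e ∈ P with ¬ r e ∈ S, s (ρ (r e)) ≤ σ / k * (ζ * (n * d / 2)) +
      4 * d / ζ * (100 * σ) + ζ / (16 * d) * (d ^ 2 * (n ^ 2 / k + 100 * n)) := by
    rw [hfib]
    -- Uncovered edges may favour large classes of S. AM-GM separates this correlation from the
    -- mean, with weights 4d/ζ and ζ/(16d) chosen so that each error term stays below ζM.
    have hterm : ∀ c, U c * s c ≤ σ / k * U c + 4 * d / ζ * (s c - σ / k) ^ 2 +
        ζ / (16 * d) * U c ^ 2 := by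
      intro c
      have h1 : 0 ≤ 4 * d / ζ * ((s c - σ / k) - ζ / (8 * d) * U c) ^ 2 := by positivity
      have h2 : 4 * d / ζ * ((s c - σ / k) - ζ / (8 * d) * U c) ^ 2 =
          4 * d / ζ * (s c - σ / k) ^ 2 - (s c - σ / k) * U c + ζ / (16 * d) * U c ^ 2 := by
        field_simp
        ring
      linarith
    refine (Finset.sum_le_sum fun c _ => hterm c).trans ?_
    rw [Finset.sum_add_distrib, Finset.sum_add_distrib, ← Finset.mul_sum, ← Finset.mul_sum,
      ← Finset.mul_sum]
    gcongr
    exact hUsum.le.trans hun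
  have hsplit : ∑ e ∈ P, s (ρ (r e)) =
      ∑ e ∈ P with r e ∈ S, s (ρ (r e)) + ∑ e ∈ P with ¬ r e ∈ S, s (ρ (r e)) :=
    (Finset.sum_filter_add_sum_filter_not P _ _).symm
  change ∑ e ∈ P, s (ρ (r e)) ≤ _
  rw [hsplit]
  set M := (n : ℝ) ^ 2 * d / (4 * k) with hM
  have hM0 : 0 < M := by positivity
  have hnd : n * d = 4 * (k / n) * M := by rw [hM]; field_simp
  have hu : (k : ℝ) / n ≤ ζ ^ 2 / 1600 := by rwa [div_le_iff₀ hn0]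
  have hndM : n * d ≤ ζ ^ 2 / 400 * M := by
    rw [hnd]
    calc 4 * (k / n) * M ≤ 4 * (ζ ^ 2 / 1600) * M := by gcongr
      _ = _ := by ring
  have hζ2 : ζ ^ 2 * M ≤ ζ * M := by
    rw [sq]
    calc ζ * ζ * M ≤ ζ * 1 * M := by gcongr
      _ = _ := by ring
  have t1 : d * (σ ^ 2 / k + 100 * σ) ≤ M + ζ * M := by
    calc d * (σ ^ 2 / k + 100 * σ) ≤ d * ((n / 2) ^ 2 / k + 100 * (n / 2)) := by gcongr
      _ = M + 50 * (n * d) := by rw [hM]; field_simp; ring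
      _ ≤ _ := by linarith [mul_pos hζ hM0]
  have t2 : σ / k * (ζ * (n * d / 2)) ≤ ζ * M := by
    calc σ / k * (ζ * (n * d / 2)) ≤ (n / 2) / k * (ζ * (n * d / 2)) := by gcongr
      _ = _ := by rw [hM]; field_simp; ring
  have t3 : 4 * d / ζ * (100 * σ) ≤ ζ * M := by
    calc 4 * d / ζ * (100 * σ) ≤ 4 * d / ζ * (100 * (n / 2)) := by gcongr
      _ = 200 / ζ * (n * d) := by ring
      _ ≤ 200 / ζ * (ζ ^ 2 / 400 * M) := by gcongr
      _ = ζ * M / 2 := by field_simp; ring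
      _ ≤ _ := by linarith [mul_pos hζ hM0]
  have t4 : ζ / (16 * d) * (d ^ 2 * (n ^ 2 / k + 100 * n)) ≤ ζ * M := by
    calc ζ / (16 * d) * (d ^ 2 * (n ^ 2 / k + 100 * n)) = ζ / 16 * (4 * M + 100 * (n * d)) := by
          rw [hM]; field_simp
      _ ≤ ζ / 16 * (4 * M + 100 * (1 / 400 * M)) := by
          have h1 : ζ * M ≤ 1 * M := by gcongr
          have h2 : n * d ≤ 1 / 400 * M := by linarith
          gcongr ζ / 16 * (4 * M + 100 * ?_)
      _ ≤ _ := by linarith [mul_pos hζ hM0]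
  linarith

/-- If half of the vertices cover almost all edges, then some clustering is cheap. -/
theorem exists_kmeansCost_le_of_cover {n k : ℕ} {ρ : Fin n → Fin k} {E : Finset (Fin n × Fin n)}
    {d ζ : ℝ} (hk : 0 < k) (hd : 0 < d) (hreg : ∀ v, mdeg Prod.fst Prod.snd E v = d)
    (hsimple : ∀ e ∈ E, ∀ f ∈ E, s(e.1, e.2) = s(f.1, f.2) → e = f)
    (hζ : 0 < ζ) (hζ1 : ζ ≤ 1) (hkn : k ≤ ζ ^ 2 / 1600 * n)
    (hmono : ((E.filter fun e => ¬ ρ e.1 ≠ ρ e.2).card : ℝ) ≤ ζ * (n * d / 4))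
    (S : Finset (Fin n)) (hS : S.card = n / 2)
    (hcov : (1 - ζ) * E.card ≤ ((E.filter fun e => e.1 ∈ S ∨ e.2 ∈ S).card : ℝ))
    (hvarS : ∑ c, ((S.filter fun v => ρ v = c).card : ℝ) ^ 2 ≤
      (S.card : ℝ) ^ 2 / k + 100 * S.card)
    (hvar : ∑ c, ((Finset.univ.filter fun v => ρ v = c).card : ℝ) ^ 2 ≤
      (n : ℝ) ^ 2 / k + 100 * n)
    [DecidableEq (EuclideanSpace ℝ (Fin (n + k)))] :
    ∃ f : EuclideanSpace ℝ (Fin (n + k)) → Fin k,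
      kmeansCost ((E.filter fun e => ρ e.1 ≠ ρ e.2).image
        fun e => edgePoint (n + k) ρ e.1 e.2) f ≤ 3 * E.card - (1 - 7 * ζ) * k * d := by
  set P := E.filter fun e => ρ e.1 ≠ ρ e.2 with hP
  have hPE : P ⊆ E := Finset.filter_subset _ _
  set r : Fin n × Fin n → Fin n := fun e => if e.1 ∈ S then e.1 else e.2 with hr
  have hrS : ∀ e, r e ∈ S ↔ (e.1 ∈ S ∨ e.2 ∈ S) := fun e => by
    by_cases h : e.1 ∈ S <;> simp [hr, h]
  have hr' : ∀ e ∈ P, r e = e.1 ∨ r e = e.2 := fun e _ => by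
    by_cases h : e.1 ∈ S <;> simp [hr, h]
  have hk0 : (0 : ℝ) < k := by exact_mod_cast hk
  have hn0 : (0 : ℝ) < n := by
    by_contra h
    have : (n : ℝ) = 0 := le_antisymm (not_lt.mp h) (by positivity)
    rw [this] at hkn
    linarith
  have hE : 2 * (E.card : ℝ) = n * d := by
    rw [← sum_mdeg (p := Prod.fst) (q := Prod.snd)]
    simp [hreg]
  -- The weight l = 2k/n is the inverse of the average size n/(2k) of a class of S, which balances
  -- the linear gain against the quadratic cost: about 2kd against kd.
  obtain ⟨f, hf⟩ := exists_kmeansCost_le (ρ := ρ) (P := P)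
    (fun e he => (Finset.mem_filter.mp he).2) hk
    (fun e he f hf => hsimple e (hPE he) f (hPE hf)) S (l := 2 * k / n) (by positivity) hr'
  refine ⟨f, hf.trans ?_⟩
  have hsplitE : ((E.filter fun e => e.1 ∈ S ∨ e.2 ∈ S).card : ℝ) +
      ((E.filter fun e => ¬ (e.1 ∈ S ∨ e.2 ∈ S)).card : ℝ) = E.card := by
    exact_mod_cast Finset.card_filter_add_card_filter_not (s := E) (fun e => e.1 ∈ S ∨ e.2 ∈ S)
  have hun : ((P.filter fun e => ¬ r e ∈ S).card : ℝ) ≤ ζ * (n * d / 2) := by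
    have : ((P.filter fun e => ¬ r e ∈ S).card : ℝ) ≤
        ((E.filter fun e => ¬ (e.1 ∈ S ∨ e.2 ∈ S)).card : ℝ) := by
      norm_cast
      refine Finset.card_le_card fun e he => ?_
      simp only [Finset.mem_filter] at he ⊢
      exact ⟨hPE he.1, fun h => he.2 ((hrS e).mpr h)⟩
    rw [← hE]
    linarith
  have hcovP : (1 - ζ) * E.card - ζ * (n * d / 4) ≤ ((P.filter fun e => r e ∈ S).card : ℝ) := by
    have : ((E.filter fun e => e.1 ∈ S ∨ e.2 ∈ S).card : ℝ) ≤
        ((P.filter fun e => r e ∈ S).card : ℝ) +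
          ((E.filter fun e => ¬ ρ e.1 ≠ ρ e.2).card : ℝ) := by
      norm_cast
      refine (Finset.card_le_card ?_).trans (Finset.card_union_le _ _)
      intro e he
      simp only [hP, Finset.mem_filter, Finset.mem_union, hrS] at he ⊢
      tauto
    linarith
  have hX := sum_card_class_le hk hd (fun v => (mdeg_mono hPE v).trans (hreg v).le) hζ hζ1 hkn S hS
    hr' hun hvarS hvar
  have h1 : (2 * (k : ℝ) / n) ^ 2 * ∑ e ∈ P, ((S.filter fun v => ρ v = ρ (r e)).card : ℝ) ≤
      (1 + 4 * ζ) * (k * d) := by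
    calc _ ≤ (2 * (k : ℝ) / n) ^ 2 * ((1 + 4 * ζ) * (n ^ 2 * d / (4 * k))) := by gcongr
      _ = _ := by field_simp; ring
  have h2 : (2 - 3 * ζ) * (k * d) ≤
      2 * (2 * (k : ℝ) / n) * ((P.filter fun e => r e ∈ S).card : ℝ) := by
    -- Uncovered edges lose 2ζkd and monochromatic ones ζkd; with the 4ζkd in `h1` this gives the
    -- 7ζ.
    calc (2 - 3 * ζ) * (k * d) = 2 * (2 * (k : ℝ) / n) * ((1 - ζ) * (n * d / 2) - ζ * (n * d / 4)) := by
          field_simp; ring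
      _ ≤ _ := by
          rw [← hE] at hcovP ⊢
          gcongr
          linarith
  have h3 : (P.card : ℝ) ≤ E.card := by exact_mod_cast Finset.card_le_card hPE
  linarith

/-! ### Counting colourings -/

section Count

variable {V Y : Type*} [Fintype V] [DecidableEq V] [Fintype Y] [DecidableEq Y]

/-- The source of all probabilities: under a uniform colouring, prescribing the colours on T has
probability |Y| to the power -|T|. -/
lemma card_cylinder (T : Finset V) (τ : V → Y) :
    (Finset.univ.filter fun ρ : V → Y => ∀ v ∈ T, ρ v = τ v).card * Fintype.card Y ^ T.card =
      Fintype.card (V → Y) := by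
  have h1 : (Finset.univ.filter fun ρ : V → Y => ∀ v ∈ T, ρ v = τ v) =
      Fintype.piFinset fun v => if v ∈ T then {τ v} else Finset.univ := by
    ext ρ
    simp only [Finset.mem_filter, Finset.mem_univ, true_and, Fintype.mem_piFinset]
    refine forall_congr' fun v => ?_
    by_cases hv : v ∈ T <;> simp [hv]
  rw [h1, Fintype.card_piFinset, Fintype.card_fun]
  have h2 : ∀ v, (if v ∈ T then {τ v} else Finset.univ : Finset Y).card =
      if v ∈ T then 1 else Fintype.card Y := fun v => by split_ifs <;> simp
  simp only [h2]
  have h3 : ∏ v, (if v ∈ T then 1 else Fintype.card Y) = Fintype.card Y ^ (Tᶜ).card := by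
    rw [Finset.prod_ite]
    simp [Finset.compl_eq_univ_sdiff, Finset.filter_notMem_eq_sdiff]
  rw [h3, ← pow_add, Finset.card_compl, Nat.sub_add_cancel (Finset.card_le_univ T)]

lemma card_cylinder_eq_div (hY : 0 < Fintype.card Y) (T : Finset V) (τ : V → Y) :
    ((Finset.univ.filter fun ρ : V → Y => ∀ v ∈ T, ρ v = τ v).card : ℝ) =
      Fintype.card (V → Y) / (Fintype.card Y : ℝ) ^ T.card := by
  rw [eq_div_iff (by positivity)]
  exact_mod_cast card_cylinder T τ

lemma card_collision (hY : 0 < Fintype.card Y) {u v : V} (huv : u ≠ v) :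
    ((Finset.univ.filter fun ρ : V → Y => ρ u = ρ v).card : ℝ) =
      Fintype.card (V → Y) / (Fintype.card Y : ℝ) := by
  have h1 : ((Finset.univ.filter fun ρ : V → Y => ρ u = ρ v).card : ℝ) =
      ∑ a, ((Finset.univ.filter fun ρ : V → Y => ∀ w ∈ ({u, v} : Finset V), ρ w = a).card : ℝ) := by
    have := Finset.card_eq_sum_card_fiberwise (s := Finset.univ.filter fun ρ : V → Y => ρ u = ρ v)
      (t := (Finset.univ : Finset Y)) (f := fun ρ => ρ u)
      (fun _ _ => Finset.mem_coe.mpr (Finset.mem_univ _))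
    rw [this]; push_cast
    refine Finset.sum_congr rfl fun a _ => ?_
    rw [Finset.filter_filter]
    congr 2
    ext ρ
    simp only [Finset.mem_filter, Finset.mem_univ, true_and, Finset.mem_insert,
      Finset.mem_singleton, forall_eq_or_imp, forall_eq]
    constructor
    · rintro ⟨h, h'⟩; exact ⟨h', h ▸ h'⟩
    · rintro ⟨h, h'⟩; exact ⟨h.trans h'.symm, h⟩
  have hk : (0 : ℝ) < Fintype.card Y := by exact_mod_cast hY
  rw [h1, Finset.sum_congr rfl fun a _ => card_cylinder_eq_div hY _ fun _ => a,
    Finset.card_pair huv, Finset.sum_const, nsmul_eq_mul, Finset.card_univ]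
  field_simp

/-- Markov's inequality for the counting measure. -/
lemma card_filter_lt_le {Ω : Type*} [Fintype Ω] {f : Ω → ℝ} (hf : ∀ ω, 0 ≤ f ω) {μ c : ℝ}
    (hμ : 0 ≤ μ) (hsum : ∑ ω, f ω ≤ μ * Fintype.card Ω) :
    c * ((Finset.univ.filter fun ω => c * μ < f ω).card : ℝ) ≤ Fintype.card Ω := by
  rcases hμ.eq_or_lt with h0 | h0
  · have hz : ∀ ω, f ω = 0 := fun ω => by
      have h1 : ∑ ω, f ω = 0 := le_antisymm (by rw [← h0] at hsum; simpa using hsum)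
        (Finset.sum_nonneg fun ω _ => hf ω)
      exact (Finset.sum_eq_zero_iff_of_nonneg fun ω _ => hf ω).mp h1 ω (Finset.mem_univ _)
    simp [hz, ← h0]
  · refine le_of_mul_le_mul_left ?_ h0
    calc μ * (c * ((Finset.univ.filter fun ω => c * μ < f ω).card : ℝ))
        = ∑ ω with c * μ < f ω, c * μ := by
          rw [Finset.sum_const, nsmul_eq_mul]; ring
      _ ≤ ∑ ω with c * μ < f ω, f ω :=
          Finset.sum_le_sum fun ω hω => (Finset.mem_filter.mp hω).2.le
      _ ≤ ∑ ω, f ω :=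
          Finset.sum_le_sum_of_subset_of_nonneg (Finset.subset_univ _) fun ω _ _ => hf ω
      _ ≤ _ := hsum

lemma card_many_monochromatic_le (hY : 0 < Fintype.card Y) (E : Finset (V × V))
    (hE : ∀ e ∈ E, e.1 ≠ e.2) :
    100 * ((Finset.univ.filter fun ρ : V → Y => 100 * ((E.card : ℝ) / Fintype.card Y) <
      ((E.filter fun e => ¬ ρ e.1 ≠ ρ e.2).card : ℝ)).card : ℝ) ≤ Fintype.card (V → Y) := by
  refine card_filter_lt_le (fun ρ => by positivity) (by positivity) ?_
  simp only [Finset.card_filter]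
  push_cast
  rw [Finset.sum_comm]
  have : ∀ e ∈ E, ∑ ρ : V → Y, (if ¬ ρ e.1 ≠ ρ e.2 then (1 : ℝ) else 0) =
      Fintype.card (V → Y) / (Fintype.card Y : ℝ) := fun e he => by
    rw [← card_collision hY (hE e he), Finset.card_filter]
    push_cast
    simp
  rw [Finset.sum_congr rfl this, Finset.sum_const, nsmul_eq_mul]
  exact le_of_eq (by ring)

/-- The sum of squares counts ordered pairs in S of equal colour, on average at most |S| + |S|²/|Y|.
By Cauchy-Schwarz the excess over |S|²/|Y| is never negative, so Markov's inequality applies to the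
excess alone. -/
lemma card_large_variance_le (hY : 0 < Fintype.card Y) (S : Finset V) :
    100 * ((Finset.univ.filter fun ρ : V → Y => (S.card : ℝ) ^ 2 / Fintype.card Y + 100 * S.card <
      ∑ c, ((S.filter fun v => ρ v = c).card : ℝ) ^ 2).card : ℝ) ≤ Fintype.card (V → Y) := by
  have hk : (0 : ℝ) < Fintype.card Y := by exact_mod_cast hY
  have hsq : ∀ ρ : V → Y, ∑ c, ((S.filter fun v => ρ v = c).card : ℝ) ^ 2 =
      ∑ u ∈ S, ∑ v ∈ S, if ρ u = ρ v then (1 : ℝ) else 0 := by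
    intro ρ
    have h1 : ∀ c, ((S.filter fun v => ρ v = c).card : ℝ) =
        ∑ v ∈ S, if ρ v = c then (1 : ℝ) else 0 := fun c => by
      rw [Finset.card_filter]; push_cast; rfl
    simp only [h1, sq, Finset.sum_mul_sum]
    rw [Finset.sum_comm]
    refine Finset.sum_congr rfl fun u _ => ?_
    rw [Finset.sum_comm]
    refine Finset.sum_congr rfl fun v _ => ?_
    simp only [mul_ite, mul_one, mul_zero]
    rw [Finset.sum_ite_eq, if_pos (Finset.mem_univ _)]
  have hcs : ∀ ρ : V → Y, 0 ≤ ∑ c, ((S.filter fun v => ρ v = c).card : ℝ) ^ 2 -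
      (S.card : ℝ) ^ 2 / Fintype.card Y := by
    intro ρ
    have h1 := sq_sum_le_card_mul_sum_sq (s := (Finset.univ : Finset Y))
      (f := fun c => ((S.filter fun v => ρ v = c).card : ℝ))
    have h2 : ∑ c, ((S.filter fun v => ρ v = c).card : ℝ) = S.card := by
      have := Finset.card_eq_sum_card_fiberwise (s := S) (t := (Finset.univ : Finset Y)) (f := ρ)
        (fun _ _ => Finset.mem_coe.mpr (Finset.mem_univ _))
      conv_rhs => rw [this]
      push_cast; rfl
    rw [h2, Finset.card_univ] at h1
    rw [sub_nonneg, div_le_iff₀ hk]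
    linarith
  have := card_filter_lt_le (c := 100) hcs (μ := S.card) (by positivity) (by
    rw [Finset.sum_sub_distrib]
    simp only [hsq]
    rw [Finset.sum_comm]
    have hpair : ∀ u ∈ S, ∑ ρ : V → Y, ∑ v ∈ S, (if ρ u = ρ v then (1 : ℝ) else 0) ≤
        Fintype.card (V → Y) + S.card * (Fintype.card (V → Y) / (Fintype.card Y : ℝ)) := by
      intro u hu
      rw [Finset.sum_comm]
      have huv : ∀ v ∈ S, ∑ ρ : V → Y, (if ρ u = ρ v then (1 : ℝ) else 0) ≤
          (if u = v then (Fintype.card (V → Y) : ℝ) else 0) +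
            Fintype.card (V → Y) / (Fintype.card Y : ℝ) := by
        intro v _
        by_cases h : u = v
        · subst h
          simp only [if_true, Finset.sum_const, nsmul_eq_mul, mul_one, Finset.card_univ]
          have : 0 ≤ (Fintype.card (V → Y) : ℝ) / (Fintype.card Y : ℝ) := by positivity
          linarith
        · rw [if_neg h, zero_add, ← card_collision hY h, Finset.card_filter]
          push_cast
          exact le_rfl
      refine (Finset.sum_le_sum huv).trans ?_
      rw [Finset.sum_add_distrib]
      simp [hu]
    have h3 := Finset.sum_le_sum hpair
    rw [Finset.sum_const, nsmul_eq_mul] at h3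
    refine (sub_le_sub_right h3 _).trans (le_of_eq ?_)
    simp only [Finset.sum_const, nsmul_eq_mul, Finset.card_univ]
    field_simp
    ring)
  convert this using 5
  rw [lt_sub_iff_add_lt, add_comm]

/-- Union bound over a vertex, four of its neighbours and their common colour. -/
lemma card_star_le (hY : 0 < Fintype.card Y) (G : SimpleGraph V) [DecidableRel G.Adj] {d : ℕ}
    (hG : G.IsRegularOfDegree d) :
    ((Finset.univ.filter fun ρ : V → Y => ∃ v a,
      4 ≤ ((G.neighborFinset v).filter fun u => ρ u = a).card).card : ℝ) ≤
      Fintype.card V * (d : ℝ) ^ 4 / (Fintype.card Y : ℝ) ^ 3 * Fintype.card (V → Y) := by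
  have hk : (0 : ℝ) < Fintype.card Y := by exact_mod_cast hY
  have hsub : (Finset.univ.filter fun ρ : V → Y => ∃ v a,
      4 ≤ ((G.neighborFinset v).filter fun u => ρ u = a).card) ⊆
      Finset.univ.biUnion fun v => ((G.neighborFinset v).powersetCard 4).biUnion fun T =>
        Finset.univ.biUnion fun a => Finset.univ.filter fun ρ : V → Y => ∀ u ∈ T, ρ u = a := by
    intro ρ hρ
    simp only [Finset.mem_filter, Finset.mem_univ, true_and] at hρ
    obtain ⟨v, a, h⟩ := hρ
    obtain ⟨T, hT, hT4⟩ := Finset.exists_subset_card_eq h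
    simp only [Finset.mem_biUnion, Finset.mem_univ, true_and, Finset.mem_powersetCard,
      Finset.mem_filter]
    exact ⟨v, T, ⟨hT.trans (Finset.filter_subset _ _), hT4⟩, a,
      fun u hu => (Finset.mem_filter.mp (hT hu)).2⟩
  calc ((Finset.univ.filter fun ρ : V → Y => ∃ v a,
      4 ≤ ((G.neighborFinset v).filter fun u => ρ u = a).card).card : ℝ)
      ≤ ∑ v, ∑ T ∈ (G.neighborFinset v).powersetCard 4, ∑ a,
        ((Finset.univ.filter fun ρ : V → Y => ∀ u ∈ T, ρ u = a).card : ℝ) := by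
        norm_cast
        refine (Finset.card_le_card hsub).trans (Finset.card_biUnion_le.trans ?_)
        refine Finset.sum_le_sum fun v _ => Finset.card_biUnion_le.trans ?_
        exact Finset.sum_le_sum fun T _ => Finset.card_biUnion_le
    _ = ∑ v, ∑ T ∈ (G.neighborFinset v).powersetCard 4,
        Fintype.card (V → Y) / (Fintype.card Y : ℝ) ^ 3 := by
        refine Finset.sum_congr rfl fun v _ => Finset.sum_congr rfl fun T hT => ?_
        rw [Finset.sum_congr rfl fun a _ => card_cylinder_eq_div hY T fun _ => a,
          (Finset.mem_powersetCard.mp hT).2, Finset.sum_const, nsmul_eq_mul, Finset.card_univ]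
        field_simp
    _ ≤ ∑ v : V, (d : ℝ) ^ 4 * (Fintype.card (V → Y) / (Fintype.card Y : ℝ) ^ 3) := by
        refine Finset.sum_le_sum fun v _ => ?_
        rw [Finset.sum_const, nsmul_eq_mul, Finset.card_powersetCard, G.card_neighborFinset_eq_degree,
          hG v]
        gcongr
        exact_mod_cast Nat.choose_le_pow d 4
    _ = _ := by
        rw [Finset.sum_const, nsmul_eq_mul, Finset.card_univ]
        ring

/-- Union bound over two colours and t pairs. Different colours keep first and second entries
disjoint, so a matching prescribes the colours of exactly 2t vertices. -/
lemma card_matching_le (hY : 0 < Fintype.card Y) (D : Finset (V × V)) (t : ℕ) :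
    ((Finset.univ.filter fun ρ : V → Y => ∃ a b, a ≠ b ∧ ∃ M ⊆ D, M.card = t ∧
      Set.InjOn Prod.fst (M : Set (V × V)) ∧ Set.InjOn Prod.snd (M : Set (V × V)) ∧
      ∀ e ∈ M, ρ e.1 = a ∧ ρ e.2 = b).card : ℝ) ≤
      (Fintype.card Y : ℝ) ^ 2 * (D.card : ℝ) ^ t / (Fintype.card Y : ℝ) ^ (2 * t) *
        Fintype.card (V → Y) := by
  classical
  have hk : (0 : ℝ) < Fintype.card Y := by exact_mod_cast hY
  let Q : Finset (V × V) → Y → Y → Finset (V → Y) := fun M a b =>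
    Finset.univ.filter fun ρ : V → Y => a ≠ b ∧ Set.InjOn Prod.fst (M : Set (V × V)) ∧
      Set.InjOn Prod.snd (M : Set (V × V)) ∧ ∀ e ∈ M, ρ e.1 = a ∧ ρ e.2 = b
  have hQ : ∀ M ∈ D.powersetCard t, ∀ a b, ((Q M a b).card : ℝ) ≤
      Fintype.card (V → Y) / (Fintype.card Y : ℝ) ^ (2 * t) := by
    intro M hM a b
    -- A colouring in `Q M a b` certifies that M is a matching and that its two sides are disjoint.
    rcases (Q M a b).eq_empty_or_nonempty with h0 | ⟨ρ₀, hρ₀⟩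
    · rw [h0, Finset.card_empty, Nat.cast_zero]
      positivity
    simp only [Q, Finset.mem_filter, Finset.mem_univ, true_and] at hρ₀
    obtain ⟨hab, h1, h2, h3⟩ := hρ₀
    have hdisj : Disjoint (M.image Prod.fst) (M.image Prod.snd) := by
      rw [Finset.disjoint_left]
      intro v hv hv'
      obtain ⟨e, he, rfl⟩ := Finset.mem_image.mp hv
      obtain ⟨f, hf, hfe⟩ := Finset.mem_image.mp hv'
      exact hab ((h3 e he).1.symm.trans (hfe ▸ (h3 f hf).2))
    have hcard : (M.image Prod.fst ∪ M.image Prod.snd).card = 2 * t := by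
      rw [Finset.card_union_of_disjoint hdisj, Finset.card_image_of_injOn h1,
        Finset.card_image_of_injOn h2, (Finset.mem_powersetCard.mp hM).2]
      ring
    rw [← hcard, ← card_cylinder_eq_div hY _ fun v => if v ∈ M.image Prod.fst then a else b]
    norm_cast
    refine Finset.card_le_card fun ρ hρ => ?_
    simp only [Q, Finset.mem_filter, Finset.mem_univ, true_and] at hρ ⊢
    intro v hv
    rcases Finset.mem_union.mp hv with h | h
    · rw [if_pos h]
      obtain ⟨e, he, rfl⟩ := Finset.mem_image.mp h
      exact (hρ.2.2.2 e he).1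
    · rw [if_neg (Finset.disjoint_right.mp hdisj h)]
      obtain ⟨e, he, rfl⟩ := Finset.mem_image.mp h
      exact (hρ.2.2.2 e he).2
  have hsub : (Finset.univ.filter fun ρ : V → Y => ∃ a b, a ≠ b ∧ ∃ M ⊆ D, M.card = t ∧
      Set.InjOn Prod.fst (M : Set (V × V)) ∧ Set.InjOn Prod.snd (M : Set (V × V)) ∧
      ∀ e ∈ M, ρ e.1 = a ∧ ρ e.2 = b) ⊆
      (D.powersetCard t).biUnion fun M => Finset.univ.biUnion fun a =>
        Finset.univ.biUnion fun b => Q M a b := by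
    intro ρ hρ
    simp only [Finset.mem_filter, Finset.mem_univ, true_and] at hρ
    obtain ⟨a, b, hab, M, hM, hMt, h⟩ := hρ
    simp only [Finset.mem_biUnion, Finset.mem_univ, true_and, Finset.mem_powersetCard, Q,
      Finset.mem_filter]
    exact ⟨M, ⟨hM, hMt⟩, a, b, hab, h⟩
  calc _ ≤ ∑ M ∈ D.powersetCard t, ∑ a : Y, ∑ b : Y, ((Q M a b).card : ℝ) := by
        norm_cast
        refine (Finset.card_le_card hsub).trans (Finset.card_biUnion_le.trans ?_)
        refine Finset.sum_le_sum fun M _ => Finset.card_biUnion_le.trans ?_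
        exact Finset.sum_le_sum fun a _ => Finset.card_biUnion_le
    _ ≤ ∑ M ∈ D.powersetCard t, ∑ a : Y, ∑ b : Y,
          Fintype.card (V → Y) / (Fintype.card Y : ℝ) ^ (2 * t) :=
        Finset.sum_le_sum fun M hM => Finset.sum_le_sum fun a _ => Finset.sum_le_sum fun b _ =>
          hQ M hM a b
    _ = (D.card.choose t : ℝ) * ((Fintype.card Y : ℝ) ^ 2 *
          (Fintype.card (V → Y) / (Fintype.card Y : ℝ) ^ (2 * t))) := by
        simp only [Finset.sum_const, nsmul_eq_mul, Finset.card_univ, Finset.card_powersetCard]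
        ring
    _ ≤ (D.card : ℝ) ^ t * ((Fintype.card Y : ℝ) ^ 2 *
          (Fintype.card (V → Y) / (Fintype.card Y : ℝ) ^ (2 * t))) := by
        gcongr
        exact_mod_cast Nat.choose_le_pow D.card t
    _ = _ := by ring

end Count

/-! ### Colour pairs with few edges, and good colourings. -/

lemma exists_matching {V : Type*} [DecidableEq V] {W : Finset (V × V)}
    (h1 : ∀ v, (W.filter fun e => e.1 = v).card ≤ 3)
    (h2 : ∀ v, (W.filter fun e => e.2 = v).card ≤ 3) (t : ℕ) (ht : 6 * t ≤ W.card) :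
    ∃ M ⊆ W, M.card = t ∧ Set.InjOn Prod.fst (M : Set (V × V)) ∧
      Set.InjOn Prod.snd (M : Set (V × V)) := by
  induction t with
  | zero => exact ⟨∅, by simp, by simp, by simp, by simp⟩
  | succ t ih =>
    obtain ⟨M, hM, hMt, hf, hs⟩ := ih (by omega)
    -- Greedy choice: each edge already chosen blocks at most three edges through either entry, so
    -- fewer than 6(t + 1) are blocked.
    have hcount : (M.biUnion fun m => (W.filter fun e => e.1 = m.1) ∪
        (W.filter fun e => e.2 = m.2)).card ≤ M.card * 6 :=
      Finset.card_biUnion_le_card_mul _ _ _ fun m _ => by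
        have := Finset.card_union_le (W.filter fun e => e.1 = m.1) (W.filter fun e => e.2 = m.2)
        have := h1 m.1
        have := h2 m.2
        omega
    obtain ⟨e, heW, he⟩ := Finset.exists_mem_notMem_of_card_lt_card
      (lt_of_le_of_lt hcount (by omega : M.card * 6 < W.card))
    simp only [Finset.mem_biUnion, Finset.mem_union, Finset.mem_filter, not_exists, not_and,
      not_or] at he
    have heM : e ∉ M := fun h => (he e h).1 heW rfl
    refine ⟨insert e M, Finset.insert_subset heW hM, by rw [Finset.card_insert_of_notMem heM, hMt],
      ?_, ?_⟩
    · rw [Finset.coe_insert, Set.injOn_insert (by simpa using heM)]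
      refine ⟨hf, ?_⟩
      rintro ⟨m, hm, hme⟩
      exact (he m hm).1 heW hme.symm
    · rw [Finset.coe_insert, Set.injOn_insert (by simpa using heM)]
      refine ⟨hs, ?_⟩
      rintro ⟨m, hm, hme⟩
      exact (he m hm).2 heW hme.symm

/-- The properties of a random colouring that make the embedding work: few monochromatic edges,
evenly spread classes of `S` and of all vertices, few edges between any two colours. -/
structure GoodColouring {n k : ℕ} (E : Finset (Fin n × Fin n)) (S : Finset (Fin n)) (t : ℕ)
    (ρ : Fin n → Fin k) : Prop where
  mono_le : ((E.filter fun e => ¬ ρ e.1 ≠ ρ e.2).card : ℝ) ≤ 100 * ((E.card : ℝ) / k)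
  var_le : ∑ c, ((Finset.univ.filter fun v => ρ v = c).card : ℝ) ^ 2 ≤
    (n : ℝ) ^ 2 / k + 100 * n
  varS_le : ∑ c, ((S.filter fun v => ρ v = c).card : ℝ) ^ 2 ≤ (S.card : ℝ) ^ 2 / k + 100 * S.card
  pair_le : ∀ a c, a ≠ c →
    (E.filter fun e => (ρ e.1 = a ∧ ρ e.2 = c) ∨ (ρ e.1 = c ∧ ρ e.2 = a)).card ≤ 12 * t

lemma card_adj_filter {V : Type*} [Fintype V] [DecidableEq V] (G : SimpleGraph V)
    [DecidableRel G.Adj] {d : ℕ} (hG : G.IsRegularOfDegree d) :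
    (Finset.univ.filter fun e : V × V => G.Adj e.1 e.2).card = Fintype.card V * d := by
  rw [Finset.card_filter, Fintype.sum_prod_type]
  have : ∀ u, (∑ v, if G.Adj u v then 1 else 0) = d := fun u => by
    rw [← hG u, ← Finset.card_filter, ← G.card_neighborFinset_eq_degree]
    congr 1
    ext v; simp
  simp [this]

lemma card_pair_lt {V Y : Type*} [Fintype V] [DecidableEq V] [DecidableEq Y] (G : SimpleGraph V)
    [DecidableRel G.Adj] {ρ : V → Y} {t : ℕ}
    (hstar : ∀ v a, ((G.neighborFinset v).filter fun u => ρ u = a).card < 4) {a b : Y}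
    (hmatch : ¬ ∃ M ⊆ Finset.univ.filter fun e : V × V => G.Adj e.1 e.2, M.card = t ∧
      Set.InjOn Prod.fst (M : Set (V × V)) ∧ Set.InjOn Prod.snd (M : Set (V × V)) ∧
      ∀ e ∈ M, ρ e.1 = a ∧ ρ e.2 = b) :
    ((Finset.univ.filter fun e : V × V => G.Adj e.1 e.2).filter
      fun e => ρ e.1 = a ∧ ρ e.2 = b).card < 6 * t := by
  set W := (Finset.univ.filter fun e : V × V => G.Adj e.1 e.2).filter
    fun e => ρ e.1 = a ∧ ρ e.2 = b with hW
  by_contra! hcon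
  obtain ⟨M, hM, hMt, h1, h2⟩ := exists_matching (W := W) (fun v => by
      refine Nat.le_of_lt_succ (lt_of_le_of_lt ?_ (hstar v b))
      refine Finset.card_le_card_of_injOn Prod.snd (fun e he => ?_) (fun e he f hf h => ?_)
      · simp only [hW, Finset.coe_filter, Finset.mem_filter, Set.mem_ofPred_eq, Finset.mem_univ,
          true_and, SimpleGraph.mem_neighborFinset] at he ⊢
        exact ⟨he.2 ▸ he.1.1, he.1.2.2⟩
      · simp only [Finset.coe_filter, Set.mem_ofPred_eq] at he hf
        exact Prod.ext (he.2.trans hf.2.symm) h) (fun v => by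
      refine Nat.le_of_lt_succ (lt_of_le_of_lt ?_ (hstar v a))
      refine Finset.card_le_card_of_injOn Prod.fst (fun e he => ?_) (fun e he f hf h => ?_)
      · simp only [hW, Finset.coe_filter, Finset.mem_filter, Set.mem_ofPred_eq, Finset.mem_univ,
          true_and, SimpleGraph.mem_neighborFinset] at he ⊢
        exact ⟨he.2 ▸ he.1.1.symm, he.1.2.1⟩
      · simp only [Finset.coe_filter, Set.mem_ofPred_eq] at he hf
        exact Prod.ext h (he.2.trans hf.2.symm)) t hcon
  exact hmatch ⟨M, hM.trans (Finset.filter_subset _ _), hMt, h1, h2,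
    fun e he => (Finset.mem_filter.mp (hM he)).2⟩

open Classical in
/-- At least 95 percent of all colourings are good. -/
theorem card_goodColouring_ge {n k d : ℕ} (hk : 0 < k) (G : SimpleGraph (Fin n))
    [DecidableRel G.Adj] (hG : G.IsRegularOfDegree d) (E : Finset (Fin n × Fin n))
    (hE : ∀ e ∈ E, G.Adj e.1 e.2) (S : Finset (Fin n)) (t : ℕ)
    (hstar : 100 * ((n : ℝ) * d ^ 4) ≤ (k : ℝ) ^ 3)
    (hmatch : 100 * ((k : ℝ) ^ 2 * (n * d) ^ t) ≤ (k : ℝ) ^ (2 * t)) :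
    95 / 100 * (Fintype.card (Fin n → Fin k) : ℝ) ≤
      ((Finset.univ.filter fun ρ : Fin n → Fin k => GoodColouring E S t ρ).card : ℝ) := by
  have hY : 0 < Fintype.card (Fin k) := by simpa using hk
  have hk0 : (0 : ℝ) < k := by exact_mod_cast hk
  have b1 := card_many_monochromatic_le hY E fun e he => (hE e he).ne
  have b2 := card_large_variance_le (V := Fin n) hY Finset.univ
  have b3 := card_large_variance_le hY S
  have b4 := card_star_le hY G hG
  have b5 := card_matching_le hY (Finset.univ.filter fun e : Fin n × Fin n => G.Adj e.1 e.2) t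
  rw [card_adj_filter G hG] at b5
  simp only [Fintype.card_fin, Finset.card_univ, Nat.cast_mul] at b1 b2 b3 b4 b5
  set N : ℝ := (Fintype.card (Fin n → Fin k) : ℝ) with hN
  have hN0 : 0 ≤ N := by positivity
  have b4' := b4.trans (mul_le_mul_of_nonneg_right
    (show (n : ℝ) * d ^ 4 / k ^ 3 ≤ 1 / 100 by rw [div_le_iff₀ (by positivity)]; linarith) hN0)
  have b5' := b5.trans (mul_le_mul_of_nonneg_right
    (show (k : ℝ) ^ 2 * (n * d) ^ t / k ^ (2 * t) ≤ 1 / 100 by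
      rw [div_le_iff₀ (by positivity)]; linarith) hN0)
  set B1 := Finset.univ.filter fun ρ : Fin n → Fin k => 100 * ((E.card : ℝ) / k) <
      ((E.filter fun e => ¬ ρ e.1 ≠ ρ e.2).card : ℝ) with hB1
  set B2 := Finset.univ.filter fun ρ : Fin n → Fin k => (n : ℝ) ^ 2 / k + 100 * n <
      ∑ c, ((Finset.univ.filter fun v => ρ v = c).card : ℝ) ^ 2 with hB2
  set B3 := Finset.univ.filter fun ρ : Fin n → Fin k => (S.card : ℝ) ^ 2 / k + 100 * S.card <
      ∑ c, ((S.filter fun v => ρ v = c).card : ℝ) ^ 2 with hB3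
  set B4 := Finset.univ.filter fun ρ : Fin n → Fin k => ∃ v a,
      4 ≤ ((G.neighborFinset v).filter fun u => ρ u = a).card with hB4
  set B5 := Finset.univ.filter fun ρ : Fin n → Fin k => ∃ a b, a ≠ b ∧
      ∃ M ⊆ Finset.univ.filter fun e : Fin n × Fin n => G.Adj e.1 e.2, M.card = t ∧
      Set.InjOn Prod.fst (M : Set (Fin n × Fin n)) ∧
      Set.InjOn Prod.snd (M : Set (Fin n × Fin n)) ∧
      ∀ e ∈ M, ρ e.1 = a ∧ ρ e.2 = b with hB5
  set Gd := Finset.univ.filter fun ρ : Fin n → Fin k => GoodColouring E S t ρ with hGd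
  -- Five bad events of probability at most 1/100 each. Without stars and matchings, each of the two
  -- orientations of a colour pair has fewer than 6t edges, whence 12t.
  have hcover : (Finset.univ : Finset (Fin n → Fin k)) ⊆ Gd ∪ (B1 ∪ (B2 ∪ (B3 ∪ (B4 ∪ B5)))) := by
    intro ρ _
    by_contra hρ
    simp only [Finset.mem_union, not_or] at hρ
    obtain ⟨h0, h1, h2, h3, h4, h5⟩ := hρ
    simp only [hB1, hB2, hB3, hB4, hB5, hGd, Finset.mem_filter, Finset.mem_univ, true_and] at *
    apply h0
    refine ⟨not_lt.mp h1, not_lt.mp h2, not_lt.mp h3, fun a c hac => ?_⟩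
    push Not at h4
    have p1 := card_pair_lt G h4 (a := a) (b := c) (t := t) fun h => h5 ⟨a, c, hac, h⟩
    have p2 := card_pair_lt G h4 (a := c) (b := a) (t := t) fun h => h5 ⟨c, a, hac.symm, h⟩
    have p3 : (E.filter fun e => (ρ e.1 = a ∧ ρ e.2 = c) ∨ (ρ e.1 = c ∧ ρ e.2 = a)).card ≤ _ :=
      (Finset.card_le_card (t := ((Finset.univ.filter fun e : Fin n × Fin n =>
        G.Adj e.1 e.2).filter fun e => ρ e.1 = a ∧ ρ e.2 = c) ∪
        ((Finset.univ.filter fun e : Fin n × Fin n =>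
        G.Adj e.1 e.2).filter fun e => ρ e.1 = c ∧ ρ e.2 = a)) fun e he => by
          simp only [Finset.mem_filter, Finset.mem_union, Finset.mem_univ, true_and] at he ⊢
          exact he.2.imp (fun h => ⟨hE e he.1, h⟩) (fun h => ⟨hE e he.1, h⟩)).trans
        (Finset.card_union_le _ _)
    omega
  have hcount : N ≤ Gd.card + (B1.card + (B2.card + (B3.card + (B4.card + B5.card)))) := by
    have h := Finset.card_le_card hcover
    rw [Finset.card_univ] at h
    have u1 := Finset.card_union_le Gd (B1 ∪ (B2 ∪ (B3 ∪ (B4 ∪ B5))))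
    have u2 := Finset.card_union_le B1 (B2 ∪ (B3 ∪ (B4 ∪ B5)))
    have u3 := Finset.card_union_le B2 (B3 ∪ (B4 ∪ B5))
    have u4 := Finset.card_union_le B3 (B4 ∪ B5)
    have u5 := Finset.card_union_le B4 B5
    rw [hN]
    exact_mod_cast (by omega)
  have b4'' : (B4.card : ℝ) ≤ 1 / 100 * N := by
    refine (Nat.cast_le.mpr (Finset.card_le_card fun ρ h => ?_)).trans b4'
    simp only [hB4, Finset.mem_filter, Finset.mem_univ, true_and] at h ⊢
    exact h
  have b5'' : (B5.card : ℝ) ≤ 1 / 100 * N := by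
    refine (Nat.cast_le.mpr (Finset.card_le_card fun ρ h => ?_)).trans b5'
    simp only [hB5, Finset.mem_filter, Finset.mem_univ, true_and] at h ⊢
    exact h
  linarith

/-- For a good colouring, the embedding is complete and sound. -/
theorem GoodColouring.kmeansCost_bounds {n k d t : ℕ} {E : Finset (Fin n × Fin n)}
    {S : Finset (Fin n)} {ρ : Fin n → Fin k} (h : GoodColouring E S t ρ) {δ ζ η : ℝ}
    (hδ0 : 0 < δ) (hδ : δ ≤ 1 / 10 ^ 3) (hζ : 0 < ζ) (hζ1 : ζ ≤ 1) (hη : 0 < η)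
    (hηδ : 7 * η ≤ δ ^ 5) (hk : 0 < k) (hd : 0 < d)
    (hreg : ∀ v, mdeg Prod.fst Prod.snd E v = d)
    (hsimple : ∀ e ∈ E, ∀ f ∈ E, s(e.1, e.2) = s(f.1, f.2) → e = f)
    (hdη : 2 * (200 / η) ^ 2 ≤ η * d) (ht : 12 * (t : ℝ) ≤ η * d) (hn : 10 / δ ≤ n)
    (hkδ : k ≤ δ ^ 2 / 242 * n) (hkζ : k ≤ ζ ^ 2 / 1600 * n)
    (hkη : 150 * n ≤ η * k ^ 2) (hkζ' : 200 ≤ ζ * k)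
    [DecidableEq (EuclideanSpace ℝ (Fin (n + k)))] :
    (S.card = n / 2 →
      (1 - ζ) * E.card ≤ ((E.filter fun e => e.1 ∈ S ∨ e.2 ∈ S).card : ℝ) →
      ∃ f : EuclideanSpace ℝ (Fin (n + k)) → Fin k,
        kmeansCost ((E.filter fun e => ρ e.1 ≠ ρ e.2).image
          fun e => edgePoint (n + k) ρ e.1 e.2) f ≤ 3 * E.card - (1 - 7 * ζ) * k * d) ∧
    ((∀ S' : Finset (Fin n), S'.card = n / 2 →
        δ * E.card ≤ ((E.filter fun e => ¬ (e.1 ∈ S' ∨ e.2 ∈ S')).card : ℝ)) →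
      ∀ f : EuclideanSpace ℝ (Fin (n + k)) → Fin k,
        3 * E.card - (1 - δ ^ 5) * k * d ≤
          kmeansCost ((E.filter fun e => ρ e.1 ≠ ρ e.2).image
            fun e => edgePoint (n + k) ρ e.1 e.2) f) := by
  have hk0 : (0 : ℝ) < k := by exact_mod_cast hk
  have hd0 : (0 : ℝ) < d := by exact_mod_cast hd
  have hn0 : (0 : ℝ) < n := lt_of_lt_of_le (by positivity) hn
  have hE : 2 * (E.card : ℝ) = n * d := by
    rw [← sum_mdeg (p := Prod.fst) (q := Prod.snd)]
    simp [hreg]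
  have hmono : ((E.filter fun e => ¬ ρ e.1 ≠ ρ e.2).card : ℝ) ≤ 50 * (n * d) / k := by
    refine h.mono_le.trans (le_of_eq ?_)
    rw [← hE]; ring
  constructor
  · intro hS hcov
    refine exists_kmeansCost_le_of_cover hk hd0 hreg hsimple hζ hζ1 hkζ (hmono.trans ?_) S hS hcov
      h.varS_le h.var_le
    rw [div_le_iff₀ hk0]
    have := mul_le_mul_of_nonneg_right hkζ' (mul_pos hn0 hd0).le
    linarith
  · intro hmiss f
    have hspread : SpreadEdges ρ d (η * d) (E.filter fun e => ρ e.1 ≠ ρ e.2) :=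
      { bichromatic := fun e he => (Finset.mem_filter.mp he).2
        simple := fun e he f hf => hsimple e (Finset.mem_of_mem_filter e he) f
          (Finset.mem_of_mem_filter f hf)
        mdeg_le := fun v => (mdeg_mono (Finset.filter_subset _ _) v).trans (hreg v).le
        card_le := fun a c hac => by
          refine le_trans ?_ ht
          have := (Finset.card_le_card (Finset.filter_subset_filter (fun e =>
            (ρ e.1 = a ∧ ρ e.2 = c) ∨ (ρ e.1 = c ∧ ρ e.2 = a)) (Finset.filter_subset
              (fun e => ρ e.1 ≠ ρ e.2) E))).trans (h.pair_le a c hac)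
          exact_mod_cast this }
    have h1 := sum_savings_le hk hreg hspread hδ0 hδ hη hηδ hd0 hdη hn hkδ (by
        refine (mul_le_mul_of_nonneg_left hmono (by norm_num)).trans ?_
        rw [mul_div_assoc', div_le_iff₀ hk0]
        have := mul_le_mul_of_nonneg_right hkη hd0.le
        linarith) h.var_le hmiss (fun e => f (edgePoint (n + k) ρ e.1 e.2))
    have h2 := kmeansCost_ge (fun e he => hspread.bichromatic e he) hspread.simple f
    have h3 : ((E.filter fun e => ρ e.1 ≠ ρ e.2).card : ℝ) +
        ((E.filter fun e => ¬ ρ e.1 ≠ ρ e.2).card : ℝ) = E.card := by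
      exact_mod_cast Finset.card_filter_add_card_filter_not (s := E) (fun e => ρ e.1 ≠ ρ e.2)
    -- The cost is at least 4|P| minus the savings, and the term -3μ in the bound on savings turns
    -- the resulting 3|P| into 3|E|.
    linarith

/-! ### Executions of the random access machine -/

/-- Within at most `T` steps, the machine gets from `s` to `s'` with probability at least `q`. -/
def Reach (w : ℕ) (prog : List Instr) (T : ℕ) (s s' : Config) (q : ℝ≥0∞) : Prop :=
  ∃ t ≤ T, q ≤ runSteps w prog t s s'

section Reach

variable {w T T' : ℕ} {prog : List Instr} {s s' s'' : Config} {q q' : ℝ≥0∞}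
  {pc r a b l x : ℕ} {reg mem : ℕ → ℕ} {inp out : List ℕ}

lemma runSteps_add (w : ℕ) (prog : List Instr) (i j : ℕ) (s : Config) :
    runSteps w prog (i + j) s = (runSteps w prog i s).bind (runSteps w prog j) := by
  induction i generalizing s with
  | zero => simp [runSteps]
  | succ i ih =>
    rw [Nat.add_right_comm]
    simp only [runSteps, PMF.bind_bind]
    congr 1
    funext s₁
    exact ih s₁

lemma Reach.refl (w : ℕ) (prog : List Instr) (s : Config) : Reach w prog T s s 1 :=
  ⟨0, Nat.zero_le _, by simp [runSteps]⟩

lemma Reach.trans (h : Reach w prog T s s' q) (h' : Reach w prog T' s' s'' q') :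
    Reach w prog (T + T') s s'' (q * q') := by
  obtain ⟨i, hi, h⟩ := h
  obtain ⟨j, hj, h'⟩ := h'
  refine ⟨i + j, by omega, ?_⟩
  rw [runSteps_add, PMF.bind_apply]
  exact (mul_le_mul' h h').trans (ENNReal.le_tsum s')

lemma Reach.mono (h : Reach w prog T s s' q) (hT : T ≤ T') : Reach w prog T' s s' q :=
  h.imp fun _ ht => ⟨ht.1.trans hT, ht.2⟩

lemma Reach.of_step (hq : q ≤ step w prog s s') (h : Reach w prog T s' s'' q') :
    Reach w prog (T + 1) s s'' (q * q') := by
  rw [add_comm]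
  exact Reach.trans ⟨1, le_rfl, by simpa [runSteps] using hq⟩ h

lemma Reach.of_step_eq (hs : step w prog s = PMF.pure s') (h : Reach w prog T s' s'' q) :
    Reach w prog (T + 1) s s'' q := by
  rw [← one_mul q]
  exact Reach.of_step (by simp [hs]) h

/-- A halted configuration stays put, so "within T steps" becomes "after exactly T steps". -/
lemma Reach.le_runSteps_of_halted (h : Reach w prog T s s' q) (hs' : s'.Halted prog) :
    q ≤ runSteps w prog T s s' := by
  obtain ⟨i, hi, h⟩ := h
  have hstep : step w prog s' = PMF.pure s' := by
    rcases hs' with h | h <;> simp [step, h]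
  have hstay : ∀ j, runSteps w prog j s' = PMF.pure s' := by
    intro j
    induction j with
    | zero => rfl
    | succ j ih => simp [runSteps, hstep, ih]
  obtain ⟨j, rfl⟩ := Nat.exists_eq_add_of_le hi
  rw [runSteps_add, PMF.bind_apply]
  refine h.trans (le_trans ?_ (ENNReal.le_tsum s'))
  simp [hstay]

lemma Reach.const (h : prog[pc]? = some (.const r x)) (hx : x < 2 ^ w)
    (H : Reach w prog T ⟨pc + 1, Function.update reg r x, mem, inp, out⟩ s' q) :
    Reach w prog (T + 1) ⟨pc, reg, mem, inp, out⟩ s' q :=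
  Reach.of_step_eq (by simp [step, h, Config.set, Nat.mod_eq_of_lt hx]) H

lemma Reach.add (h : prog[pc]? = some (.add r a b)) (hx : reg a + reg b = x) (hw : x < 2 ^ w)
    (H : Reach w prog T ⟨pc + 1, Function.update reg r x, mem, inp, out⟩ s' q) :
    Reach w prog (T + 1) ⟨pc, reg, mem, inp, out⟩ s' q :=
  Reach.of_step_eq (by simp [step, h, Config.set, hx, Nat.mod_eq_of_lt hw]) H

lemma Reach.sub (h : prog[pc]? = some (.sub r a b)) (hx : reg a - reg b = x)
    (H : Reach w prog T ⟨pc + 1, Function.update reg r x, mem, inp, out⟩ s' q) :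
    Reach w prog (T + 1) ⟨pc, reg, mem, inp, out⟩ s' q :=
  Reach.of_step_eq (by simp [step, h, Config.set, hx]) H

lemma Reach.load (h : prog[pc]? = some (.load r a)) (hx : mem (reg a) = x)
    (H : Reach w prog T ⟨pc + 1, Function.update reg r x, mem, inp, out⟩ s' q) :
    Reach w prog (T + 1) ⟨pc, reg, mem, inp, out⟩ s' q :=
  Reach.of_step_eq (by simp [step, h, Config.set, hx]) H

lemma Reach.store {y : ℕ} (h : prog[pc]? = some (.store a b)) (hx : reg a = x) (hy : reg b = y)
    (H : Reach w prog T ⟨pc + 1, reg, Function.update mem x y, inp, out⟩ s' q) :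
    Reach w prog (T + 1) ⟨pc, reg, mem, inp, out⟩ s' q :=
  Reach.of_step_eq (by simp [step, h, hx, hy]) H

lemma Reach.read (h : prog[pc]? = some (.read r)) (hx : x < 2 ^ w)
    (H : Reach w prog T ⟨pc + 1, Function.update reg r x, mem, inp, out⟩ s' q) :
    Reach w prog (T + 1) ⟨pc, reg, mem, x :: inp, out⟩ s' q :=
  Reach.of_step_eq (by simp [step, h, Config.set, Nat.mod_eq_of_lt hx]) H

lemma Reach.print (h : prog[pc]? = some (.print r)) (hx : reg r = x)
    (H : Reach w prog T ⟨pc + 1, reg, mem, inp, out ++ [x]⟩ s' q) :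
    Reach w prog (T + 1) ⟨pc, reg, mem, inp, out⟩ s' q :=
  Reach.of_step_eq (by simp [step, h, hx]) H

lemma Reach.jump (h : prog[pc]? = some (.jpos r l)) (hx : 0 < reg r)
    (H : Reach w prog T ⟨l, reg, mem, inp, out⟩ s' q) :
    Reach w prog (T + 1) ⟨pc, reg, mem, inp, out⟩ s' q :=
  Reach.of_step_eq (by simp [step, h, hx]) H

lemma Reach.no_jump (h : prog[pc]? = some (.jpos r l)) (hx : reg r = 0)
    (H : Reach w prog T ⟨pc + 1, reg, mem, inp, out⟩ s' q) :
    Reach w prog (T + 1) ⟨pc, reg, mem, inp, out⟩ s' q :=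
  Reach.of_step_eq (by simp [step, h, hx]) H

lemma uniformBelow_apply {k x : ℕ} (hx : x < k) : uniformBelow k x = (k : ℝ≥0∞)⁻¹ := by
  have h : (Finset.range k).Nonempty := ⟨x, by simpa using hx⟩
  rw [uniformBelow, dif_pos h, PMF.uniformOfFinset_apply, if_pos (by simpa using hx),
    Finset.card_range]

/-- The only rule that costs probability. The outcome x is prescribed in advance, so an execution is
followed for one fixed colouring at a time. -/
lemma Reach.rand {k : ℕ} (h : prog[pc]? = some (.rand r a)) (hk : reg a = k) (hx : x < k)
    (H : Reach w prog T ⟨pc + 1, Function.update reg r x, mem, inp, out⟩ s' q) :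
    Reach w prog (T + 1) ⟨pc, reg, mem, inp, out⟩ s' ((k : ℝ≥0∞)⁻¹ * q) := by
  refine Reach.of_step (s' := ⟨pc + 1, Function.update reg r x, mem, inp, out⟩) ?_ H
  rw [← uniformBelow_apply hx]
  simp only [step, h, hk, Config.set]
  rw [PMF.map_apply]
  refine le_trans ?_ (ENNReal.le_tsum x)
  simp

end Reach

/-! ### The program -/

/-- The program draws a colour for every vertex, and then prints the points of the edges whose
endpoints have different colours. Registers: `0` holds `n`, `1` holds `k`, `2` the number of
remaining edges, `3` the number of vertices without a colour, `4` and `11` the constants one and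
four, `7` and `8` the current edge, `9` and `10` its colours. -/
def embedProg : List Instr :=
  -- Register 13 is never written and stays 0, so adding it copies n. Two truncated subtractions
  -- test whether the colours differ, and a jump on register 4 is unconditional.
  [.read 0, .read 1, .read 2, .const 4 1, .const 11 4, .add 5 0 1, .print 5, .add 3 0 13,
    .sub 3 3 4, .rand 5 1, .store 3 5, .jpos 3 8,
    .read 7, .read 8, .load 9 7, .load 10 8, .sub 5 9 10, .jpos 5 21, .sub 5 10 9, .jpos 5 21,
    .jpos 4 32,
    .print 11, .print 7, .print 4, .print 8, .print 4, .add 5 0 9, .print 5, .print 4,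
    .add 5 0 10, .print 5, .print 4,
    .sub 2 2 4, .jpos 2 12, .halt]

/-- The words that the program prints for the edge `uv` under the colouring `ρ`. -/
def edgeWords (n : ℕ) (ρ : ℕ → ℕ) (u v : ℕ) : List ℕ :=
  if ρ u = ρ v then [] else [4, u, 1, v, 1, n + ρ u, 1, n + ρ v, 1]

section Program

variable {w n k : ℕ} {ρ : ℕ → ℕ}

/-- The loop runs down from vertex i to 0. That cells above i are untouched lets the induction keep
the colours stored earlier. -/
lemma reach_colour_loop (hρ : ∀ j < n, ρ j < k) {i m : ℕ} (hi : i < n) {reg mem : ℕ → ℕ}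
    {inp out : List ℕ} (h0 : reg 0 = n) (h1 : reg 1 = k) (h2 : reg 2 = m) (h3 : reg 3 = i + 1)
    (h4 : reg 4 = 1) (h11 : reg 11 = 4) :
    ∃ reg' mem', Reach w embedProg (4 * (i + 1)) ⟨8, reg, mem, inp, out⟩
        ⟨12, reg', mem', inp, out⟩ ((k : ℝ≥0∞)⁻¹ ^ (i + 1)) ∧
      reg' 0 = n ∧ reg' 2 = m ∧ reg' 4 = 1 ∧ reg' 11 = 4 ∧
      (∀ j ≤ i, mem' j = ρ j) ∧ ∀ j, i < j → mem' j = mem j := by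
  induction i generalizing reg mem with
  | zero =>
    refine ⟨Function.update (Function.update reg 3 0) 5 (ρ 0), Function.update mem 0 (ρ 0), ?_,
      by simp [h0], by simp [h2], by simp [h4], by simp [h11], ?_, ?_⟩
    · rw [zero_add, pow_one, ← mul_one (k : ℝ≥0∞)⁻¹]
      refine Reach.sub (x := 0) rfl (by simp [h3, h4]) ?_
      refine Reach.rand (x := ρ 0) rfl (by simp [h1]) (hρ 0 hi) ?_
      refine Reach.store rfl (x := 0) (y := ρ 0) (by simp) (by simp) ?_
      exact Reach.no_jump rfl (by simp) (Reach.refl _ _ _)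
    · intro j hj
      obtain rfl : j = 0 := by omega
      simp
    · intro j hj
      rw [Function.update_of_ne (by omega)]
  | succ i ih =>
    obtain ⟨reg', mem', hR, g0, g2, g4, g11, gm, gm'⟩ := ih (by omega)
      (reg := Function.update (Function.update reg 3 (i + 1)) 5 (ρ (i + 1)))
      (mem := Function.update mem (i + 1) (ρ (i + 1)))
      (by simp [h0]) (by simp [h1]) (by simp [h2]) (by simp) (by simp [h4]) (by simp [h11])
    refine ⟨reg', mem', ?_, g0, g2, g4, g11, ?_, ?_⟩
    · rw [pow_succ', show 4 * (i + 1 + 1) = 4 * (i + 1) + 1 + 1 + 1 + 1 by ring]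
      refine Reach.sub (x := i + 1) rfl (by simp [h3, h4]) ?_
      refine Reach.rand (x := ρ (i + 1)) rfl (by simp [h1]) (hρ _ hi) ?_
      refine Reach.store rfl (x := i + 1) (y := ρ (i + 1)) (by simp) (by simp) ?_
      exact Reach.jump rfl (by simp) hR
    · intro j hj
      rcases Nat.le_succ_iff.mp hj with h | rfl
      · exact gm j h
      · rw [gm' _ (Nat.lt_succ_self i)]; simp
    · intro j hj
      rw [gm' j (by omega), Function.update_of_ne (by omega)]

lemma reach_edge_body (hw : n + k < 2 ^ w) (hρ : ∀ j < n, ρ j < k) {u v m : ℕ} (hu : u < n)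
    (hv : v < n) {reg mem : ℕ → ℕ} {inp out : List ℕ} (h0 : reg 0 = n) (h2 : reg 2 = m + 1)
    (h4 : reg 4 = 1) (h11 : reg 11 = 4) (hmem : ∀ j < n, mem j = ρ j) :
    ∃ reg', Reach w embedProg 21 ⟨12, reg, mem, u :: v :: inp, out⟩
        ⟨33, reg', mem, inp, out ++ edgeWords n ρ u v⟩ 1 ∧
      reg' 0 = n ∧ reg' 2 = m ∧ reg' 4 = 1 ∧ reg' 11 = 4 := by
  have hu' := hρ u hu
  have hv' := hρ v hv
  have hprint : ∀ reg : ℕ → ℕ, reg 0 = n → reg 2 = m + 1 → reg 4 = 1 → reg 11 = 4 → reg 7 = u →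
      reg 8 = v → reg 9 = ρ u → reg 10 = ρ v → ρ u ≠ ρ v →
      ∃ reg', Reach w embedProg 12 ⟨21, reg, mem, inp, out⟩
        ⟨33, reg', mem, inp, out ++ edgeWords n ρ u v⟩ 1 ∧
      reg' 0 = n ∧ reg' 2 = m ∧ reg' 4 = 1 ∧ reg' 11 = 4 := by
    intro reg h0 h2 h4 h11 h7 h8 h9 h10 hne
    refine ⟨Function.update (Function.update (Function.update reg 5 (n + ρ u)) 5 (n + ρ v)) 2 m, ?_,
      by simp [h0], by simp, by simp [h4], by simp [h11]⟩
    refine Reach.print rfl h11 ?_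
    refine Reach.print rfl h7 ?_
    refine Reach.print rfl h4 ?_
    refine Reach.print rfl h8 ?_
    refine Reach.print rfl h4 ?_
    refine Reach.add (x := n + ρ u) rfl (by simp [h0, h9]) (by omega) ?_
    refine Reach.print (x := n + ρ u) rfl (by simp) ?_
    refine Reach.print (x := 1) rfl (by simp [h4]) ?_
    refine Reach.add (x := n + ρ v) rfl (by simp [h0, h10]) (by omega) ?_
    refine Reach.print (x := n + ρ v) rfl (by simp) ?_
    refine Reach.print (x := 1) rfl (by simp [h4]) ?_
    refine Reach.sub (x := m) rfl (by simp [h2, h4]) ?_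
    simp only [edgeWords, if_neg hne, List.append_assoc, List.cons_append, List.nil_append]
    exact Reach.refl _ _ _
  set reg₁ := Function.update (Function.update (Function.update (Function.update reg 7 u) 8 v) 9
    (ρ u)) 10 (ρ v) with hreg₁
  have hstart : ∀ {s : Config} {T : ℕ}, Reach w embedProg T ⟨16, reg₁, mem, inp, out⟩ s 1 →
      Reach w embedProg (T + 4) ⟨12, reg, mem, u :: v :: inp, out⟩ s 1 := by
    intro s T h
    refine Reach.read rfl (by omega) ?_
    refine Reach.read rfl (by omega) ?_
    refine Reach.load (x := ρ u) rfl (by simp [hmem u hu]) ?_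
    exact Reach.load (x := ρ v) rfl (by simp [hmem v hv]) h
  rcases lt_trichotomy (ρ u) (ρ v) with h | h | h
  · obtain ⟨reg', hR, h'⟩ := hprint
      (Function.update (Function.update reg₁ 5 (ρ u - ρ v)) 5 (ρ v - ρ u))
      (by simp [hreg₁, h0]) (by simp [hreg₁, h2]) (by simp [hreg₁, h4]) (by simp [hreg₁, h11])
      (by simp [hreg₁]) (by simp [hreg₁]) (by simp [hreg₁]) (by simp [hreg₁]) h.ne
    refine ⟨reg', Reach.mono (hstart (T := 16) ?_) (by norm_num), h'⟩
    refine Reach.sub (x := ρ u - ρ v) rfl (by simp [hreg₁]) ?_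
    refine Reach.no_jump rfl (by simp; omega) ?_
    refine Reach.sub (x := ρ v - ρ u) rfl (by simp [hreg₁]) ?_
    exact Reach.jump rfl (by simp; omega) hR
  · refine ⟨Function.update (Function.update (Function.update reg₁ 5 0) 5 0) 2 m,
      Reach.mono (hstart (T := 6) ?_) (by norm_num), by simp [hreg₁, h0], by simp,
      by simp [hreg₁, h4], by simp [hreg₁, h11]⟩
    simp only [edgeWords, if_pos h, List.append_nil]
    refine Reach.sub (x := 0) rfl (by simp [hreg₁, h]) ?_
    refine Reach.no_jump rfl (by simp) ?_
    refine Reach.sub (x := 0) rfl (by simp [hreg₁, h]) ?_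
    refine Reach.no_jump rfl (by simp) ?_
    refine Reach.jump rfl (by simp [hreg₁, h4]) ?_
    exact Reach.sub (x := m) rfl (by simp [hreg₁, h2, h4]) (Reach.refl _ _ _)
  · obtain ⟨reg', hR, h'⟩ := hprint (Function.update reg₁ 5 (ρ u - ρ v))
      (by simp [hreg₁, h0]) (by simp [hreg₁, h2]) (by simp [hreg₁, h4]) (by simp [hreg₁, h11])
      (by simp [hreg₁]) (by simp [hreg₁]) (by simp [hreg₁]) (by simp [hreg₁]) h.ne'
    refine ⟨reg', Reach.mono (hstart (T := 14) ?_) (by norm_num), h'⟩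
    refine Reach.sub (x := ρ u - ρ v) rfl (by simp [hreg₁]) ?_
    exact Reach.jump rfl (by simp; omega) hR

lemma reach_edge_loop (hw : n + k < 2 ^ w) (hρ : ∀ j < n, ρ j < k) {es : List (ℕ × ℕ)}
    (hes : ∀ e ∈ es, e.1 < n ∧ e.2 < n) (hne : es ≠ []) {reg mem : ℕ → ℕ} {out : List ℕ}
    (h0 : reg 0 = n) (h2 : reg 2 = es.length) (h4 : reg 4 = 1) (h11 : reg 11 = 4)
    (hmem : ∀ j < n, mem j = ρ j) :
    ∃ reg', Reach w embedProg (22 * es.length)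
      ⟨12, reg, mem, es.flatMap fun e => [e.1, e.2], out⟩
      ⟨34, reg', mem, [], out ++ es.flatMap fun e => edgeWords n ρ e.1 e.2⟩ 1 := by
  induction es generalizing reg out with
  | nil => exact absurd rfl hne
  | cons e es ih =>
    have he := hes e (by simp)
    obtain ⟨reg₁, hR, g0, g2, g4, g11⟩ := reach_edge_body hw hρ he.1 he.2
      (inp := es.flatMap fun e => [e.1, e.2]) (out := out) h0 h2 h4 h11 hmem
    rcases es.eq_nil_or_concat' with rfl | hne'
    · refine ⟨reg₁, ?_⟩
      have := hR.trans (Reach.no_jump (T := 0) rfl (by simpa using g2) (Reach.refl _ _ _))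
      simpa using this
    · obtain ⟨reg', hR'⟩ := ih (fun e he => hes e (by simp [he]))
        (by rintro rfl; simp at hne') (out := out ++ edgeWords n ρ e.1 e.2) g0 g2 g4 g11
      refine ⟨reg', ?_⟩
      have := hR.trans (Reach.jump (pc := 33) rfl (by
        rw [g2]; obtain ⟨a, b, rfl⟩ := hne'; simp) hR')
      simp only [List.flatMap_cons, List.length_cons, one_mul, List.append_assoc] at this ⊢
      exact this.mono (by omega)

/-- For every colouring, the program ends with this colouring in memory and with the corresponding
output, with probability at least `k ^ (-n)`. -/
theorem reach_halt (hw : n + k < 2 ^ w) (hw4 : 4 < 2 ^ w) (hρ : ∀ j < n, ρ j < k) (hn : 0 < n)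
    {es : List (ℕ × ℕ)} (hes : ∀ e ∈ es, e.1 < n ∧ e.2 < n) (hne : es ≠ [])
    (hlen : es.length < 2 ^ w) :
    ∃ reg' mem', Reach w embedProg (8 + 4 * n + 22 * es.length)
      (Config.init (n :: k :: es.length :: es.flatMap fun e => [e.1, e.2]))
      ⟨34, reg', mem', [], (n + k) :: es.flatMap fun e => edgeWords n ρ e.1 e.2⟩
      ((k : ℝ≥0∞)⁻¹ ^ n) ∧ ∀ j < n, mem' j = ρ j := by
  obtain ⟨i, rfl⟩ : ∃ i, n = i + 1 := ⟨n - 1, by omega⟩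
  set n := i + 1 with hn'
  set reg₀ : ℕ → ℕ := Function.update (Function.update (Function.update (Function.update
    (Function.update (Function.update (Function.update (fun _ => 0) 0 n) 1 k) 2 es.length)
    4 1) 11 4) 5 (n + k)) 3 n with hreg₀
  obtain ⟨reg₁, mem₁, hR₁, g0, g2, g4, g11, gm, -⟩ := reach_colour_loop (w := w) hρ
    (i := i) (m := es.length) (by omega) (reg := reg₀) (mem := fun _ => 0)
    (inp := es.flatMap fun e => [e.1, e.2]) (out := [n + k]) (by simp [hreg₀]) (by simp [hreg₀])
    (by simp [hreg₀]) (by simp [hreg₀, hn']) (by simp [hreg₀]) (by simp [hreg₀])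
  obtain ⟨reg₂, hR₂⟩ := reach_edge_loop hw hρ hes hne (out := [n + k]) g0 g2 g4 g11
    (fun j hj => gm j (by omega))
  refine ⟨reg₂, mem₁, ?_, fun j hj => gm j (by omega)⟩
  have hR := hR₁.trans hR₂
  rw [mul_one] at hR
  rw [show 8 + 4 * n + 22 * es.length =
    4 * (i + 1) + 22 * es.length + 1 + 1 + 1 + 1 + 1 + 1 + 1 + 1 by omega]
  refine Reach.read rfl (by omega) ?_
  refine Reach.read rfl (by omega) ?_
  refine Reach.read rfl (by omega) ?_
  refine Reach.const rfl (by omega) ?_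
  refine Reach.const rfl hw4 ?_
  refine Reach.add (x := n + k) rfl (by simp) hw ?_
  refine Reach.print (x := n + k) rfl (by simp) ?_
  exact Reach.add (x := n) rfl (by simp) (by omega) hR

end Program

/-! ### The distribution of the final configuration -/

section Uniform

variable {ι A : Type*} [Fintype ι] {p : PMF A} {F : ι → A}

/-- The lower bounds on the values `F i` already exhaust the total mass 1, leaving nothing for other
outcomes. -/
lemma mem_range_of_mem_support (hF : Function.Injective F)
    (hp : ∀ i, (Fintype.card ι : ℝ≥0∞)⁻¹ ≤ p (F i)) (hι : 0 < Fintype.card ι) {s : A}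
    (hs : s ∈ p.support) : s ∈ Set.range F := by
  classical
  by_contra hsF
  have hnot : s ∉ Finset.univ.image F := by
    simpa using fun i hi => hsF ⟨i, hi⟩
  have h1 : ∑ a ∈ insert s (Finset.univ.image F), p a ≤ 1 := by
    rw [← p.tsum_coe]; exact ENNReal.sum_le_tsum _
  rw [Finset.sum_insert hnot, Finset.sum_image hF.injOn] at h1
  have h2 : (1 : ℝ≥0∞) ≤ ∑ i, p (F i) := by
    calc (1 : ℝ≥0∞) = ∑ _i : ι, (Fintype.card ι : ℝ≥0∞)⁻¹ := by
          rw [Finset.sum_const, Finset.card_univ, nsmul_eq_mul, ENNReal.mul_inv_cancel]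
          · exact_mod_cast hι.ne'
          · exact ENNReal.natCast_ne_top _
      _ ≤ _ := Finset.sum_le_sum fun i _ => hp i
  have h3 : p s + 1 ≤ 0 + 1 := by
    rw [zero_add]
    exact (add_le_add le_rfl h2).trans h1
  have h4 : p s ≤ 0 := (ENNReal.add_le_add_iff_right (by simp)).mp h3
  exact hs (le_antisymm h4 zero_le)

lemma le_toOuterMeasure_of_card_le (hF : Function.Injective F)
    (hp : ∀ i, (Fintype.card ι : ℝ≥0∞)⁻¹ ≤ p (F i)) (hι : 0 < Fintype.card ι) {I : Finset ι}
    (hI : 95 / 100 * (Fintype.card ι : ℝ) ≤ I.card) {B : Set A} (hB : ∀ i ∈ I, F i ∈ B) :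
    95 / 100 ≤ p.toOuterMeasure B := by
  classical
  rw [PMF.toOuterMeasure_apply]
  have h1 : ∑ i ∈ I, p (F i) ≤ ∑' a, B.indicator p a := by
    refine le_trans (le_of_eq ?_) (ENNReal.sum_le_tsum (I.image F))
    rw [Finset.sum_image hF.injOn]
    exact Finset.sum_congr rfl fun i hi => (Set.indicator_of_mem (hB i hi) _).symm
  refine le_trans ?_ h1
  have h2 : (I.card : ℝ≥0∞) * (Fintype.card ι : ℝ≥0∞)⁻¹ ≤ ∑ i ∈ I, p (F i) := by
    rw [← nsmul_eq_mul, ← Finset.sum_const]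
    exact Finset.sum_le_sum fun i _ => hp i
  refine le_trans ?_ h2
  rw [← div_eq_mul_inv, ENNReal.le_div_iff_mul_le (by left; exact_mod_cast hι.ne')
    (by left; exact ENNReal.natCast_ne_top _)]
  have h3 : 95 * Fintype.card ι ≤ 100 * I.card := by
    have : (95 : ℝ) * Fintype.card ι ≤ 100 * I.card := by linarith
    exact_mod_cast this
  rw [← ENNReal.mul_div_right_comm]
  refine ENNReal.div_le_of_le_mul ?_
  rw [mul_comm (I.card : ℝ≥0∞)]
  exact_mod_cast h3

end Uniform

/-! ### Graphs given by edge lists -/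

section EdgeList

variable {n d : ℕ} {G : SimpleGraph (Fin n)} {es : List (Fin n × Fin n)}

lemma IsEdgeList.adj (h : IsEdgeList G es) {e : Fin n × Fin n} (he : e ∈ es) : G.Adj e.1 e.2 := by
  rw [← SimpleGraph.mem_edgeSet, ← h.2]
  exact List.mem_map_of_mem he

lemma IsEdgeList.eq_of_sym2_eq (h : IsEdgeList G es) {e f : Fin n × Fin n} (he : e ∈ es)
    (hf : f ∈ es) (hef : s(e.1, e.2) = s(f.1, f.2)) : e = f :=
  List.inj_on_of_nodup_map h.1 he hf hef

lemma IsEdgeList.nodup (h : IsEdgeList G es) : es.Nodup := List.Nodup.of_map _ h.1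

variable [DecidableRel G.Adj]

lemma IsEdgeList.image_toFinset (h : IsEdgeList G es) :
    es.toFinset.image (fun e => s(e.1, e.2)) = G.edgeFinset := by
  ext e
  rw [SimpleGraph.mem_edgeFinset, ← h.2]
  simp

lemma IsEdgeList.card_filter (h : IsEdgeList G es) (r : Sym2 (Fin n) → Prop) [DecidablePred r] :
    (es.toFinset.filter fun e => r s(e.1, e.2)).card = (G.edgeFinset.filter r).card := by
  rw [← h.image_toFinset, Finset.filter_image, Finset.card_image_of_injOn]
  intro e he f hf hef
  simp only [Finset.coe_filter, Set.mem_ofPred_eq, List.mem_toFinset] at he hf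
  exact h.eq_of_sym2_eq he.1 hf.1 hef

lemma IsEdgeList.card_toFinset (h : IsEdgeList G es) :
    es.toFinset.card = G.edgeFinset.card := by
  simpa using h.card_filter fun _ => True

lemma IsEdgeList.length_eq (h : IsEdgeList G es) : es.length = G.edgeFinset.card := by
  rw [← h.card_toFinset, List.toFinset_card_of_nodup h.nodup]

lemma IsEdgeList.mdeg_eq (h : IsEdgeList G es) (hG : G.IsRegularOfDegree d) (v : Fin n) :
    mdeg Prod.fst Prod.snd es.toFinset v = d := by
  rw [mdeg_eq_card fun e he => (h.adj (List.mem_toFinset.mp he)).ne]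
  norm_cast
  rw [← hG v, ← G.card_incidenceFinset_eq_degree, SimpleGraph.incidenceFinset_eq_filter,
    ← h.card_filter]
  congr 1
  ext e
  simp [eq_comm]

lemma IsEdgeList.two_mul_length (h : IsEdgeList G es) (hG : G.IsRegularOfDegree d) :
    2 * es.length = n * d := by
  have h1 := sum_mdeg (p := Prod.fst) (q := Prod.snd) (C := es.toFinset)
  rw [Finset.sum_congr rfl fun v _ => h.mdeg_eq hG v, List.toFinset_card_of_nodup h.nodup] at h1
  simp only [Finset.sum_const, Finset.card_univ, Fintype.card_fin, nsmul_eq_mul] at h1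
  exact_mod_cast h1.symm

lemma IsEdgeList.card_covered (h : IsEdgeList G es) (S : Finset (Fin n)) :
    (es.toFinset.filter fun e => e.1 ∈ S ∨ e.2 ∈ S).card = (coveredEdges G S).card := by
  rw [coveredEdges, ← h.card_filter]
  congr 1
  ext e
  simp only [Finset.mem_filter, Sym2.mem_iff]
  grind

lemma IsEdgeList.card_missed (h : IsEdgeList G es) (S : Finset (Fin n)) :
    (es.toFinset.filter fun e => ¬ (e.1 ∈ S ∨ e.2 ∈ S)).card = (missedEdges G S).card := by
  rw [missedEdges, ← h.card_filter]
  congr 1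
  ext e
  simp only [Finset.mem_filter, Sym2.mem_iff]
  grind

end EdgeList

/-! ### The output of the program -/

/-- The sparse vectors for the bichromatic edges in a list. -/
def sparsePoints {n k : ℕ} (ρ : Fin n → Fin k) (es : List (Fin n × Fin n)) :
    List (List (ℕ × ℕ)) :=
  (es.filter fun e => ρ e.1 ≠ ρ e.2).map fun e =>
    [((e.1 : ℕ), 1), ((e.2 : ℕ), 1), (n + ρ e.1, 1), (n + ρ e.2, 1)]

section Output

variable {n k : ℕ} {ρ : Fin n → Fin k} {es : List (Fin n × Fin n)}

lemma sparsePoint_eq_edgePoint (D : ℕ) (e : Fin n × Fin n) :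
    sparsePoint D [((e.1 : ℕ), 1), ((e.2 : ℕ), 1), (n + ρ e.1, 1), (n + ρ e.2, 1)] =
      edgePoint D ρ e.1 e.2 := by
  unfold sparsePoint edgePoint
  congr 1
  funext j
  simp only [List.filter_cons, List.filter_nil, eq_comm (a := (j : ℕ)), decide_eq_true_eq]
  split_ifs <;> norm_num

lemma sparsePoints_map (D : ℕ) : (sparsePoints ρ es).map (sparsePoint D) =
    (es.filter fun e => ρ e.1 ≠ ρ e.2).map fun e => edgePoint D ρ e.1 e.2 := by
  simp only [sparsePoints, List.map_map]
  exact List.map_congr_left fun e _ => sparsePoint_eq_edgePoint D e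

open Classical in
lemma pointSet_sparsePoints (D : ℕ) : pointSet D (sparsePoints ρ es) =
    (es.toFinset.filter fun e => ρ e.1 ≠ ρ e.2).image fun e => edgePoint D ρ e.1 e.2 := by
  rw [pointSet, sparsePoints_map]
  ext p
  simp

lemma encodeOutput_sparsePoints (r : ℕ → ℕ) (hr : ∀ v : Fin n, r v = ρ v) :
    encodeOutput (n + k) (sparsePoints ρ es) =
      (n + k) :: (es.map fun e => ((e.1 : ℕ), (e.2 : ℕ))).flatMap
        fun e => edgeWords n r e.1 e.2 := by
  rw [encodeOutput]
  congr 1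
  induction es with
  | nil => rfl
  | cons e es ih =>
    simp only [List.map_cons, List.flatMap_cons, ← ih]
    by_cases h : ρ e.1 = ρ e.2
    · simp [sparsePoints, edgeWords, hr, h]
    · have h' : ¬ (ρ e.1 : ℕ) = ρ e.2 := fun h' => h (Fin.ext h')
      simp [sparsePoints, edgeWords, hr, h, h']

end Output

/-- The final configurations of the program, one for every colouring. -/
lemma exists_final_configs {n k d : ℕ} {G : SimpleGraph (Fin n)} [DecidableRel G.Adj]
    {es : List (Fin n × Fin n)} (hd : 1 ≤ d) (hk : 1 ≤ k) (hkn : k ≤ n)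
    (hG : G.IsRegularOfDegree d) (hes : IsEdgeList G es) :
    ∃ F : (Fin n → Fin k) → Config, Function.Injective F ∧ ∀ ρ,
      (Fintype.card (Fin n → Fin k) : ℝ≥0∞)⁻¹ ≤
        runLinear embedProg 2 30 (graphInput n k es) (F ρ) ∧
      (F ρ).Halted embedProg ∧
      (F ρ).out = encodeOutput (n + k) (sparsePoints ρ es) := by
  have hlen := hes.two_mul_length hG
  have hn : 0 < n := by omega
  have hnd : n ≤ 2 * es.length := by rw [hlen]; exact Nat.le_mul_of_pos_right n hd
  have hinput : (graphInput n k es).length = 3 + 2 * es.length := by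
    simp only [graphInput, List.length_cons, List.length_flatMap, List.length_nil]
    simp
    ring
  set N := 3 + 2 * es.length with hN
  -- The factor 2 in the word length makes room for n + k ≤ 2n ≤ 4|E|, which can exceed the input
  -- length N = 2|E| + 3.
  have hw : (N + 1) * (N + 1) ≤ 2 ^ (2 * N.size) := by
    rw [two_mul, pow_add]
    exact Nat.mul_le_mul (Nat.lt_size_self N) (Nat.lt_size_self N)
  have hw' : 2 * (N + 1) ≤ 2 ^ (2 * N.size) := le_trans (Nat.mul_le_mul_right _ (by omega)) hw
  have key : ∀ ρ : Fin n → Fin k, ∃ s : Config,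
      (Fintype.card (Fin n → Fin k) : ℝ≥0∞)⁻¹ ≤
        runLinear embedProg 2 30 (graphInput n k es) s ∧
      s.Halted embedProg ∧ s.out = encodeOutput (n + k) (sparsePoints ρ es) ∧
      ∀ v : Fin n, s.mem v = ρ v := by
    intro ρ
    set r : ℕ → ℕ := fun j => if h : j < n then ρ ⟨j, h⟩ else 0 with hr
    have hrρ : ∀ v : Fin n, r v = ρ v := fun v => by simp [hr]
    obtain ⟨reg, mem, hR, hmem⟩ := reach_halt (w := 2 * N.size) (n := n) (k := k) (ρ := r)
      (by omega) (by omega) (fun j hj => by simp [hr, hj]) hn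
      (es := es.map fun e => ((e.1 : ℕ), (e.2 : ℕ)))
      (by
        intro e he
        obtain ⟨e', -, rfl⟩ := List.mem_map.mp he
        exact ⟨e'.1.2, e'.2.2⟩)
      (by
        intro h
        have := congrArg List.length h
        simp only [List.length_map, List.length_nil] at this
        omega)
      (by rw [List.length_map]; omega)
    have hhalt : (⟨34, reg, mem, [], (n + k) :: (es.map fun e => ((e.1 : ℕ), (e.2 : ℕ))).flatMap
        fun e => edgeWords n r e.1 e.2⟩ : Config).Halted embedProg := Or.inr rfl
    refine ⟨_, ?_, hhalt, (encodeOutput_sparsePoints r hrρ).symm, fun v => by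
      rw [← hrρ]; exact hmem v v.2⟩
    have h1 := (hR.mono (T' := 30 * N) (by rw [List.length_map]; omega)).le_runSteps_of_halted hhalt
    rw [runLinear, hinput]
    refine le_trans (le_of_eq ?_) (h1.trans (le_of_eq ?_))
    · rw [Fintype.card_fun, Fintype.card_fin, Fintype.card_fin, Nat.cast_pow, ENNReal.inv_pow]
    · rw [graphInput, List.flatMap_map, List.length_map]
  choose F hF using key
  -- Final configurations are distinct because the colouring remains readable in memory, even where
  -- the output does not determine it.
  refine ⟨F, fun ρ ρ' h => ?_, fun ρ => ⟨(hF ρ).1, (hF ρ).2.1, (hF ρ).2.2.1⟩⟩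
  funext v
  have h1 := (hF ρ).2.2.2 v
  rw [h, (hF ρ').2.2.2 v] at h1
  exact Fin.ext h1.symm

/-! ### Growth of the parameters -/

/-- As L > 1, d outgrows every multiple of log n; as d ≥ 1 and g ≥ 0 eventually, k = o(n/d^g) gives
k = o(n). -/
lemma eventually_parameters {L : ℝ} {d k : ℕ → ℕ} {g : ℕ → ℝ} (hL : 1 < L)
    (hd : (fun n => (d n : ℝ)) =Θ[atTop] (fun n => Real.log (n : ℝ) ^ L))
    (hg : Tendsto g atTop atTop)
    (hk : (fun n => (k n : ℝ)) =o[atTop] (fun n => (n : ℝ) / (d n : ℝ) ^ g n))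
    {R ε : ℝ} (hR : 1 ≤ R) (hε : 0 < ε) :
    ∀ᶠ n : ℕ in atTop, R ≤ d n ∧ R * Real.log n ≤ d n ∧ (k n : ℝ) ≤ ε * n := by
  obtain ⟨c, hc, hcd⟩ := hd.2.exists_pos
  have hlog : Tendsto (fun n : ℕ => Real.log (n : ℝ)) atTop atTop :=
    Real.tendsto_log_atTop.comp tendsto_natCast_atTop_atTop
  have hpow : Tendsto (fun n : ℕ => Real.log (n : ℝ) ^ (L - 1)) atTop atTop :=
    (tendsto_rpow_atTop (by linarith)).comp hlog
  filter_upwards [hcd.bound, hlog.eventually_ge_atTop 1, hpow.eventually_ge_atTop (c * R),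
    hg.eventually_ge_atTop 0, hk.def hε] with n h1 h2 h3 h4 h5
  have hl0 : 0 < Real.log (n : ℝ) := by linarith
  have hRlog : R * Real.log n ≤ d n := by
    rw [Real.norm_of_nonneg (by positivity), Real.norm_of_nonneg (by positivity)] at h1
    refine le_of_mul_le_mul_left ?_ hc
    calc c * (R * Real.log n) = c * R * Real.log n := by ring
      _ ≤ Real.log n ^ (L - 1) * Real.log n := by gcongr
      _ = Real.log n ^ L := by
        rw [← Real.rpow_add_one hl0.ne']; congr 1; ring
      _ ≤ _ := h1
  have hRd : R ≤ d n := le_trans (le_mul_of_one_le_right (by linarith) h2) hRlog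
  refine ⟨hRd, hRlog, ?_⟩
  have hdg : 1 ≤ (d n : ℝ) ^ g n := Real.one_le_rpow (hR.trans hRd) h4
  rw [Real.norm_of_nonneg (by positivity), Real.norm_of_nonneg (by positivity)] at h5
  refine h5.trans ?_
  gcongr
  exact div_le_self (by positivity) hdg

/-- For parameters in the right range, star and matching events are rare. -/
lemma parameter_bounds {n d k t : ℕ} {η : ℝ} (hη : 0 < η) (hn : 300 ≤ n) (hd3 : (3 : ℝ) ≤ d)
    (hdlog : 36 / η * Real.log n ≤ d) (hkn : (k : ℝ) ≤ 1 / 100 * n) (hk : √(n : ℝ) * d < k)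
    (ht : η * d / 12 - 1 ≤ t) :
    100 * ((n : ℝ) * d ^ 4) ≤ (k : ℝ) ^ 3 ∧
      100 * ((k : ℝ) ^ 2 * (n * d) ^ t) ≤ (k : ℝ) ^ (2 * t) := by
  have hn' : (300 : ℝ) ≤ n := by exact_mod_cast hn
  have hs0 : 0 < √(n : ℝ) := Real.sqrt_pos.mpr (by linarith)
  have hss : √(n : ℝ) * √(n : ℝ) = n := Real.mul_self_sqrt (by linarith)
  have hd0 : (0 : ℝ) < d := by linarith
  have hk2 : (n : ℝ) * d * d ≤ k ^ 2 := by
    calc (n : ℝ) * d * d = (√(n : ℝ) * d) ^ 2 := by rw [mul_pow, sq, hss]; ring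
      _ ≤ _ := by gcongr
  -- The lower bound √n·d < k and the upper bound k ≤ n/100 together force d to be small.
  have hds : 100 * (d : ℝ) ≤ √(n : ℝ) := by
    refine le_of_mul_le_mul_left ?_ hs0
    rw [hss]; linarith
  constructor
  · have h1 : 100 * (d : ℝ) * d ≤ k := by
      refine le_trans ?_ hk.le
      gcongr
    calc 100 * ((n : ℝ) * d ^ 4) = (n * d * d) * (100 * d * d) := by ring
      _ ≤ k ^ 2 * k := by gcongr
      _ = _ := by ring
  -- As nd² ≤ k², the matching bound has a spare factor d^t. Since t ≥ 3 log n - 1 and d ≥ 3 ≥ e, it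
  -- is at least n³/3, which beats the 100k² from the choice of colours.
  · have hdt : 100 * (k : ℝ) ^ 2 ≤ (d : ℝ) ^ t := by
      have h1 : 3 * Real.log n - 1 ≤ t := by
        refine le_trans ?_ ht
        have : 36 * Real.log n ≤ η * d := by
          have := mul_le_mul_of_nonneg_left hdlog hη.le
          have e : η * (36 / η * Real.log n) = 36 * Real.log n := by field_simp
          linarith
        linarith
      have he : Real.exp 1 ≤ 3 := by
        have := Real.exp_one_lt_d9
        linarith
      have h2 : (n : ℝ) ^ 3 ≤ 3 * (d : ℝ) ^ t := by
        calc (n : ℝ) ^ 3 = Real.exp (3 * Real.log n) := by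
              rw [← Real.log_rpow (by linarith), Real.exp_log (by positivity)]
              norm_cast
          _ ≤ Real.exp (1 + t) := Real.exp_le_exp.mpr (by linarith)
          _ = Real.exp 1 * Real.exp 1 ^ t := by
              rw [Real.exp_add, ← Real.exp_nat_mul, mul_one]
          _ ≤ 3 * (d : ℝ) ^ t := by
              gcongr
              exact he.trans hd3
      have h3 : (k : ℝ) ^ 2 ≤ n ^ 2 := pow_le_pow_left₀ (by positivity) (by linarith) 2
      have h4 : 300 * (n : ℝ) ^ 2 ≤ n ^ 3 := by
        rw [pow_succ' _ 2]; gcongr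
      linarith
    calc 100 * ((k : ℝ) ^ 2 * (n * d) ^ t) = 100 * (k : ℝ) ^ 2 * (n * d) ^ t := by ring
      _ ≤ (d : ℝ) ^ t * (n * d) ^ t := by gcongr
      _ = (n * d * d) ^ t := by rw [← mul_pow]; ring
      _ ≤ ((k : ℝ) ^ 2) ^ t := by gcongr
      _ = _ := by rw [pow_mul]

/-! ### Correctness of the printed points, and the main theorem. -/

lemma edgePoint_swap {n k : ℕ} (D : ℕ) (ρ : Fin n → Fin k) (u v : Fin n) :
    edgePoint D ρ u v = edgePoint D ρ v u := by
  unfold edgePoint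
  congr 1
  funext j
  ring

lemma edgePoint_injOn_edgeList {n k : ℕ} {G : SimpleGraph (Fin n)} {es : List (Fin n × Fin n)}
    (hes : IsEdgeList G es) (ρ : Fin n → Fin k) :
    Set.InjOn (fun e : Fin n × Fin n => edgePoint (n + k) ρ e.1 e.2) es.toFinset :=
  edgePoint_injOn (fun _ he => (hes.adj (List.mem_toFinset.mp he)).ne) fun _ he _ hf =>
    hes.eq_of_sym2_eq (List.mem_toFinset.mp he) (List.mem_toFinset.mp hf)

/-- The printed vectors are the colour-coded embeddings of the bichromatic edges. -/
lemma sparsePoints_spec {n k : ℕ} {G : SimpleGraph (Fin n)} [DecidableRel G.Adj]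
    {es : List (Fin n × Fin n)} (hes : IsEdgeList G es) (ρ : Fin n → Fin k) :
    (sparsePoints ρ es).length ≤ G.edgeFinset.card ∧
      (∀ p ∈ sparsePoints ρ es, ∀ q ∈ p, q.1 < n + k) ∧
      ((sparsePoints ρ es).map (sparsePoint (n + k))).Nodup ∧
      (pointSet (n + k) (sparsePoints ρ es) : Set (EuclideanSpace ℝ (Fin (n + k)))) =
        {p | ∃ u v, G.Adj u v ∧ ρ u ≠ ρ v ∧ p = edgePoint (n + k) ρ u v} := by
  refine ⟨?_, ?_, ?_, ?_⟩
  · rw [sparsePoints, List.length_map, ← hes.length_eq]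
    exact List.length_filter_le _ _
  · intro p hp q hq
    obtain ⟨e, -, rfl⟩ := List.mem_map.mp hp
    have h1 := e.1.2
    have h2 := e.2.2
    have h3 := (ρ e.1).2
    have h4 := (ρ e.2).2
    simp only [List.mem_cons, List.not_mem_nil, or_false] at hq
    rcases hq with rfl | rfl | rfl | rfl <;> dsimp only <;> omega
  · rw [sparsePoints_map]
    refine List.Nodup.map_on (fun e he f hf h => ?_) (hes.nodup.filter _)
    exact edgePoint_injOn_edgeList hes ρ (by simpa using List.mem_of_mem_filter he)
      (by simpa using List.mem_of_mem_filter hf) h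
  · rw [pointSet_sparsePoints]
    ext p
    simp only [Finset.coe_image, Finset.coe_filter, List.mem_toFinset, Set.mem_image,
      Set.mem_ofPred_eq]
    constructor
    · rintro ⟨e, ⟨he, hρ⟩, rfl⟩
      exact ⟨e.1, e.2, hes.adj he, hρ, rfl⟩
    · rintro ⟨u, v, huv, hρ, rfl⟩
      rw [← SimpleGraph.mem_edgeSet, ← hes.2, List.mem_map] at huv
      obtain ⟨e, he, hse⟩ := huv
      rcases Sym2.eq_iff.mp hse with ⟨rfl, rfl⟩ | ⟨rfl, rfl⟩
      · exact ⟨e, ⟨he, hρ⟩, rfl⟩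
      · exact ⟨e, ⟨he, hρ.symm⟩, edgePoint_swap _ _ _ _⟩

theorem theorem5p2 (δ ζ α : ℝ) (hδ0 : 0 < δ) (hδ : δ ≤ 1 / 10 ^ 3)
    (hζ0 : 0 < ζ) (hζ : ζ ≤ δ ^ 5 / 10) (hα0 : 0 < α) (hα : α ≤ δ ^ 10) :
    ∃ (prog : List Instr) (c C : ℕ),
      -- On every regular graph of positive degree, for every random outcome, the program stops
      -- in linear time and prints at most `|E|` colour-coded edge embeddings in `O(|V|)` dimensions.
      (∀ (n k d : ℕ) (G : SimpleGraph (Fin n)) [DecidableRel G.Adj] (es : List (Fin n × Fin n)),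
        1 ≤ d → 1 ≤ k → k ≤ n → G.IsRegularOfDegree d → IsEdgeList G es →
        ∀ s ∈ (runLinear prog c C (graphInput n k es)).support,
          s.Halted prog ∧
          ∃ (D : ℕ) (pts : List (List (ℕ × ℕ))),
            s.out = encodeOutput D pts ∧
            D ≤ C * n ∧
            pts.length ≤ G.edgeFinset.card ∧
            (∀ p ∈ pts, ∀ q ∈ p, q.1 < D) ∧
            (pts.map (sparsePoint D)).Nodup ∧
            ∃ ρ : Fin n → Fin k, n + k ≤ D ∧
              (pointSet D pts : Set (EuclideanSpace ℝ (Fin D))) =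
                {p | ∃ u v, G.Adj u v ∧ ρ u ≠ ρ v ∧ p = edgePoint D ρ u v}) ∧
      -- On the promised inputs, the printed point set is good with probability at least 0.95.
      (∀ (L : ℝ) (d k κ : ℕ → ℕ) (a : ℝ) (g : ℕ → ℝ),
        1 < L →
        (fun n => (d n : ℝ)) =Θ[atTop] (fun n => Real.log (n : ℝ) ^ L) →
        (fun n => (κ n : ℝ)) =O[atTop] (fun n => Real.log (n : ℝ) ^ a) →
        Tendsto g atTop atTop →
        (fun n => (k n : ℝ)) =o[atTop] (fun n => (n : ℝ) / (d n : ℝ) ^ g n) →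
        ∀ᶠ n : ℕ in atTop, √(n : ℝ) * d n < k n →
          ∀ (G : SimpleGraph (Fin n)) [DecidableRel G.Adj] (es : List (Fin n × Fin n)),
            IsSmallSetVertexExpander G (κ n) α (d n) → IsEdgeList G es →
            95 / 100 ≤ (runLinear prog c C (graphInput n (k n) es)).toOuterMeasure
              {s | ∃ (D : ℕ) (pts : List (List (ℕ × ℕ))),
                s.out = encodeOutput D pts ∧
                -- completeness
                ((∃ S : Finset (Fin n), S.card = n / 2 ∧
                    (1 - ζ) * (G.edgeFinset.card : ℝ) ≤ ((coveredEdges G S).card : ℝ)) →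
                  ∃ f : EuclideanSpace ℝ (Fin D) → Fin (k n),
                    kmeansCost (pointSet D pts) f ≤
                      3 * (G.edgeFinset.card : ℝ) - (1 - 7 * ζ) * k n * d n) ∧
                -- soundness
                ((∀ S : Finset (Fin n), S.card = n / 2 →
                    δ * (G.edgeFinset.card : ℝ) ≤ ((missedEdges G S).card : ℝ)) →
                  ∀ f : EuclideanSpace ℝ (Fin D) → Fin (k n),
                    3 * (G.edgeFinset.card : ℝ) - (1 - δ ^ 5) * k n * d n ≤
                      kmeansCost (pointSet D pts) f)}) := by
  refine ⟨embedProg, 2, 30, ?_, ?_⟩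
  · intro n k d G _ es hd hk hkn hG hes s hs
    obtain ⟨F, hF, hFρ⟩ := exists_final_configs hd hk hkn hG hes
    have : Nonempty (Fin k) := ⟨⟨0, hk⟩⟩
    obtain ⟨ρ, rfl⟩ := mem_range_of_mem_support hF (fun ρ => (hFρ ρ).1) Fintype.card_pos hs
    obtain ⟨h1, h2, h3, h4⟩ := sparsePoints_spec hes ρ
    exact ⟨(hFρ ρ).2.1, n + k, sparsePoints ρ es, (hFρ ρ).2.2, by omega, h1, h2, h3, ρ, le_rfl, h4⟩
  · intro L d k κ a g hL hd _ hg hk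
    set η : ℝ := δ ^ 5 / 7 with hη
    have hη0 : 0 < η := by positivity
    have hζ1 : ζ ≤ 1 := by
      refine hζ.trans ?_
      have : δ ^ 5 ≤ 1 := pow_le_one₀ hδ0.le (hδ.trans (by norm_num))
      linarith
    set ε : ℝ := min (1 / 100) (min (δ ^ 2 / 242) (ζ ^ 2 / 1600)) with hε
    have hε0 : 0 < ε := by positivity
    -- Each summand is one lower bound required of d, or of d/log n for the last; adding them meets
    -- all at once.
    set R : ℝ := 2 * (200 / η) ^ 2 / η + 150 / η + 200 / ζ + 3 + 36 / η with hR
    have r1 : 0 < 2 * (200 / η) ^ 2 / η := by positivity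
    have r2 : 0 < 150 / η := by positivity
    have r3 : 0 < 200 / ζ := by positivity
    have r4 : 0 < 36 / η := by positivity
    filter_upwards [eventually_parameters hL hd hg hk (R := R) (by linarith) hε0,
      eventually_ge_atTop 300, tendsto_natCast_atTop_atTop.eventually_ge_atTop (10 / δ)]
      with n hn hn300 hnδ hkd G _ es hexp hes
    obtain ⟨hRd, hRlog, hkε⟩ := hn
    generalize d n = d at *
    generalize k n = k at *
    have hG := hexp.1
    have hd3 : (3 : ℝ) ≤ d := by linarith
    have hd0 : 0 < d := by
      have : (0 : ℝ) < d := by linarith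
      exact_mod_cast this
    have hn0 : (300 : ℝ) ≤ n := by exact_mod_cast hn300
    have hlog0 : 0 ≤ Real.log n := Real.log_nonneg (by linarith)
    have hkε' : ∀ {x : ℝ}, ε ≤ x → (k : ℝ) ≤ x * n := fun hx =>
      hkε.trans (mul_le_mul_of_nonneg_right hx (by linarith))
    have hk100 : (k : ℝ) ≤ 1 / 100 * n := hkε' (min_le_left _ _)
    have hkn : k ≤ n := by
      have : (k : ℝ) ≤ n := by linarith
      exact_mod_cast this
    have hsqrt : 1 ≤ √(n : ℝ) := Real.one_le_sqrt.mpr (by linarith)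
    have hdk : (d : ℝ) ≤ k := (le_mul_of_one_le_left (by linarith) hsqrt).trans hkd.le
    have hk0 : 0 < k := by
      have : (0 : ℝ) < k := by linarith
      exact_mod_cast this
    have hlogR : 36 / η * Real.log n ≤ d :=
      le_trans (mul_le_mul_of_nonneg_right (by linarith) hlog0) hRlog
    have hηR : ∀ {x : ℝ}, x / η ≤ R → x ≤ η * d := fun hx => by
      have := (div_le_iff₀ hη0).mp (hx.trans hRd)
      linarith
    -- The largest t for which the bound 12t on the edges between two colours is at most ηd.
    set t : ℕ := ⌊η * d / 12⌋₊ with ht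
    have ht1 : (t : ℝ) ≤ η * d / 12 := Nat.floor_le (by positivity)
    have ht2 : η * d / 12 - 1 ≤ t := (Nat.sub_one_lt_floor _).le
    obtain ⟨hstar, hmatch⟩ := parameter_bounds hη0 hn300 hd3 hlogR hk100 hkd ht2
    -- The cover is fixed before the colouring is drawn, so evenness of its classes is a single
    -- event; if no cover exists, the empty set serves as a dummy.
    obtain ⟨S, hS⟩ : ∃ S : Finset (Fin n), (∃ S' : Finset (Fin n), S'.card = n / 2 ∧
        (1 - ζ) * (G.edgeFinset.card : ℝ) ≤ ((coveredEdges G S').card : ℝ)) →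
        S.card = n / 2 ∧ (1 - ζ) * (G.edgeFinset.card : ℝ) ≤ ((coveredEdges G S).card : ℝ) := by
      by_cases h : ∃ S' : Finset (Fin n), S'.card = n / 2 ∧
        (1 - ζ) * (G.edgeFinset.card : ℝ) ≤ ((coveredEdges G S').card : ℝ)
      · exact ⟨h.choose, fun _ => h.choose_spec⟩
      · exact ⟨∅, fun h' => absurd h' h⟩
    classical
    have hgood := card_goodColouring_ge hk0 G hG es.toFinset
      (fun e he => hes.adj (List.mem_toFinset.mp he)) S t hstar hmatch
    obtain ⟨F, hF, hFρ⟩ := exists_final_configs hd0 hk0 hkn hG hes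
    have : Nonempty (Fin k) := ⟨⟨0, hk0⟩⟩
    refine le_toOuterMeasure_of_card_le hF (fun ρ => (hFρ ρ).1) Fintype.card_pos hgood ?_
    intro ρ hρ
    have hρ' : GoodColouring es.toFinset S t ρ := (Finset.mem_filter.mp hρ).2
    have hmain := hρ'.kmeansCost_bounds hδ0 hδ hζ0 hζ1 hη0 (by rw [hη]; linarith) hk0 hd0
      (hes.mdeg_eq hG)
      (fun e he f hf => hes.eq_of_sym2_eq (List.mem_toFinset.mp he) (List.mem_toFinset.mp hf))
      (hηR (by linarith)) (by linarith) hnδ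
      (hkε' ((min_le_right _ _).trans (min_le_left _ _)))
      (hkε' ((min_le_right _ _).trans (min_le_right _ _)))
      (by
        have h1 : (150 : ℝ) ≤ η * d := hηR (by linarith)
        have h2 : (n : ℝ) * d ≤ k ^ 2 := by
          calc (n : ℝ) * d ≤ n * (d * d) := by
                gcongr
                exact le_mul_of_one_le_left (by linarith) (by linarith)
            _ = (√(n : ℝ) * d) ^ 2 := by rw [mul_pow, Real.sq_sqrt (by linarith)]; ring
            _ ≤ _ := by gcongr
        calc 150 * (n : ℝ) ≤ η * d * n := by gcongr
          _ = η * (n * d) := by ring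
          _ ≤ _ := by gcongr)
      (by
        have h1 : 200 / ζ ≤ k := by linarith
        rw [div_le_iff₀ hζ0] at h1
        linarith)
    rw [hes.card_toFinset, hes.card_covered, ← pointSet_sparsePoints] at hmain
    simp only [hes.card_missed] at hmain
    exact ⟨n + k, sparsePoints ρ es, (hFρ ρ).2.2, fun h => hmain.1 (hS h).1 (hS h).2, hmain.2⟩
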